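/- Notation. Let $q$ be a power of two and $\mathbb F_q$ the field with $q$ elements. For $f\in\mathbb F_q[X_1,\dots,X_m]$ and $\mathbf i\in\mathbb Z_{\ge 0}^m$, the Hasse derivative $f^{(\mathbf i)}(\mathbf X)$ is the coefficient of $\mathbf Y^{\mathbf i}$ in $f(\mathbf X+\mathbf Y)$, and $f^{(<s)}(\mathbf w)\in\mathbb F_q^{\binom{s+m-1}{m}}$ is the vector of all $f^{(\mathbf i)}(\mathbf w)$ with $i_1+\dots+i_m<s$. Univariate polynomials satisfy $f\equiv_s g$ if $f^{(<s)}(x)=g^{(<s)}(x)$ for all $x\in\mathbb F_q$. The $[m,s,d,q]$ lifted multiplicity code, of length $q^m$ over the alphabet $\mathbb F_q^{\binom{s+m-1}{m}}$, is the set of all words $(f^{(<s)}(\mathbf w))_{\mathbf w\in\mathbb F_q^m}$, where $f\in\mathbb F_q[X_1,\dots,X_m]$ is such that for all $\mathbf w,\mathbf v\in\mathbb F_q^m$ there is $g\in\mathbb F_q[T]$ with $\deg g<d$ and $f(\mathbf w+\mathbf vT)\equiv_s g(T)$. The rate of a code $C\subseteq\Sigma^N$ is $\log_{|\Sigma|}|C|/N$;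 its relative distance is the minimum, over pairs of distinct codewords, of the Hamming distance divided by $N$ (read as $+\infty$ if there is only one codeword). Let $A_m$ be the real $m\times m$ matrix, with rows $j$ and columns $k$ numbered $0,\dots,m-1$, whose entry in column $0$ of row $j$ is $\sum_{i\ge 2j+1}\binom mi$ and whose entry in row $j$ and column $k\ge1$ is $\binom{m}{2j+1-k}$ (zero if $2j+1-k<0$). **Theorem (Rate and distance of lifted multiplicity codes).** Fix an integer $m\ge 1$. Then $A_m$ has a largest real eigenvalue $\lambda_m$. Let $s$ and $q$ be powers of two with $m\le s\le q$, and let $r$ be an integer with $1\le r\le q$. 1. The rate of the $[m,s,qs-r,q]$ lifted multiplicity code is $$1-O_m\left(s^{-1}(q/r)^{\log_2\lambda_m-m}\right)\qquad\text{as } q\to\infty,$$ where the implied constant and the threshold for $q$ depend only on $m$ (not on $s$ or $r$). 2. The relative distance $\Delta$ of the $[m,s,qs-r,q]$ lifted multiplicity code satisfies $$\Delta\ \ge\ \Delta_{\min}:=\left\lceil\frac{r-s+1}{s}\right\rceil\frac{q-s}{q^2}.$$ 3. Along any sequence of such parameters $(s,q,r)$ with $q\to\infty$ and $s=o(q)$,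 we have $\Delta_{\min}=\frac{r}{qs}(1+o(1))$ if and only if $(r\bmod s)=o(r)$; the latter condition holds, for instance, if $s\mid r$ or if $s=o(r)$. -/

import Mathlib

open Filter Asymptotics

universe u

noncomputable section

namespace LiftedMult

/-- The rate `log_{|A|} |C| / N` of a code `C ⊆ A ^ N`, coordinates indexed by `ι`, `N = |ι|`. -/
def codeRate {ι A : Type*} (C : Set (ι → A)) : ℝ :=
  Real.logb (Nat.card A : ℝ) (Nat.card C : ℝ) / (Nat.card ι : ℝ)

open Classical in
/-- The relative distance of a code `C ⊆ A ^ N`: the least value of (Hamming distance) / `N` over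
all pairs of distinct codewords, with value `⊤` for a code that has no such pair. -/
def relativeDistance {ι A : Type*} [Fintype ι] (C : Set (ι → A)) : EReal :=
  ⨅ c ∈ C, ⨅ c' ∈ C, ⨅ _ : c ≠ c',
    (((hammingDist c c' : ℝ) / (Fintype.card ι : ℝ) : ℝ) : EReal)

/-- The polynomial `f(X + Y)`, as a polynomial in `Y` with coefficients in `F[X]`. -/
def shift {m : ℕ} {F : Type*} [Field F] (f : MvPolynomial (Fin m) F) :
    MvPolynomial (Fin m) (MvPolynomial (Fin m) F) :=
  MvPolynomial.aeval (fun j => MvPolynomial.C (MvPolynomial.X j) + MvPolynomial.X j) f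

/-- The `i`-th Hasse derivative of `f`: the coefficient of `Y ^ i` in `f(X + Y)`. -/
def mvHasseDeriv {m : ℕ} {F : Type*} [Field F] (i : Fin m →₀ ℕ) (f : MvPolynomial (Fin m) F) :
    MvPolynomial (Fin m) F :=
  MvPolynomial.coeff i (shift f)

/-- The alphabet: vectors over `F` indexed by the exponents `i` in `m` variables of total
degree `< s` (there are `(s + m - 1).choose m` of these). -/
abbrev Alphabet (m s : ℕ) (F : Type*) : Type _ := {i : Fin m →₀ ℕ // i.degree < s} → F

/-- `f ^ (< s) (w)`: all Hasse derivatives of `f` of order less than `s` at the point `w`. -/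
def derivVec {m : ℕ} {F : Type*} [Field F] (s : ℕ) (f : MvPolynomial (Fin m) F)
    (w : Fin m → F) : Alphabet m s F :=
  fun i => MvPolynomial.eval w (mvHasseDeriv i.1 f)

/-- The restriction `f(w + v T)` of `f` to the line `w + v T`. -/
def lineRestrict {m : ℕ} {F : Type*} [Field F] (f : MvPolynomial (Fin m) F)
    (w v : Fin m → F) : Polynomial F :=
  MvPolynomial.aeval (fun j => Polynomial.C (w j) + Polynomial.C (v j) * Polynomial.X) f

/-- Univariate polynomials equivalent up to order `s`: all Hasse derivatives of order less
than `s` agree at every point of `F`. -/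
def EquivUpTo {F : Type*} [Field F] (s : ℕ) (f g : Polynomial F) : Prop :=
  ∀ k < s, ∀ x : F, (Polynomial.hasseDeriv k f).eval x = (Polynomial.hasseDeriv k g).eval x

/-- The `[m, s, d, q]` lifted multiplicity code, where `q = |F|`: evaluations `f ^ (< s)` on all of
`F ^ m` of the polynomials `f` whose restriction to each line is equivalent up to order `s` to
some univariate polynomial of degree less than `d`. -/
def liftedMultiplicityCode (m s d : ℕ) (F : Type*) [Field F] :
    Set ((Fin m → F) → Alphabet m s F) :=
  {c | ∃ f : MvPolynomial (Fin m) F,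
    (∀ w v : Fin m → F, ∃ g : Polynomial F,
      g.degree < (d : WithBot ℕ) ∧ EquivUpTo s (lineRestrict f w v) g) ∧
    c = fun w => derivVec s f w}

/-- The matrix `A_m`. With rows and columns numbered from `0`, row `j` has the entry
`∑_{i ≥ 2j+1} (m choose i)` in column `0` and `(m choose 2j+1-k)` in column `k ≥ 1`
(zero when `2j+1-k < 0`). -/
def matA (m : ℕ) : Matrix (Fin m) (Fin m) ℝ :=
  Matrix.of fun j k =>
    if (k : ℕ) = 0 then ∑ i ∈ Finset.Icc (2 * (j : ℕ) + 1) m, (m.choose i : ℝ)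
    else if (k : ℕ) ≤ 2 * (j : ℕ) + 1 then (m.choose (2 * (j : ℕ) + 1 - (k : ℕ)) : ℝ)
    else 0

/-- The set of real eigenvalues of `A_m`. -/
def eigenvaluesA (m : ℕ) : Set ℝ :=
  {μ | Module.End.HasEigenvalue (Matrix.toLin' (matA m)) μ}

/-- `λ_m`, the largest eigenvalue of `A_m`. -/
def topEigenvalue (m : ℕ) : ℝ := sSup (eigenvaluesA m)

/-- `Δ_min = ⌈(r - s + 1) / s⌉ (q - s) / q ^ 2`. -/
def deltaMin (s q r : ℕ) : ℝ :=
  (⌈((r : ℝ) - (s : ℝ) + 1) / (s : ℝ)⌉ : ℝ) * (((q : ℝ) - (s : ℝ)) / (q : ℝ) ^ 2)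

/-- The admissible parameters: `s` and `q` are powers of two, `m ≤ s ≤ q` and `1 ≤ r ≤ q`. -/
def Admissible (m s q r : ℕ) : Prop :=
  (∃ a : ℕ, s = 2 ^ a) ∧ (∃ l : ℕ, q = 2 ^ l) ∧ m ≤ s ∧ s ≤ q ∧ 1 ≤ r ∧ r ≤ q

end LiftedMult

end

/-! Rate. Put u = T^q - T. The products of (X_j^q - X_j)^(a_j) X_j^(b_j) with |a| < s and b_j < q
form a basis of the space of all words: at w the expansion of such a product starts with ± w^b Y^a,
so the system is triangular in a. It therefore suffices to count the products that may fall outside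
the code.

On a line, such a product is a scalar times u^|a| ∏ (w_j + v_j T)^(b_j). In characteristic 2, Lucas
leaves only powers T^|e| with e below b in binary. Substituting T^q = T + u gives degree below qs -
r modulo u^s, unless |a| ≥ s - m and some such e has |e| mod q + ⌊|e|/q⌋ ≥ q - r
(`lineHom_basisPoly_mem`). The window for |a| contains a fraction O(1/s) of all a. The condition on
b forces the binary digits of |e| mod q above a position near log₂ r to be 1. Removing the digits of
b from the bottom, with a bound on the carry, gives a recursion whose matrix, in increments of that
bound, is A_m (`card_carrySet_le`). For m ≥ 2 its leading block is irreducible, and a Perron vector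
shows that the first row of A_m^n is O(μ^n) for an eigenvalue μ ≤ λ_m (`exists_eigenvalue_growth`).

Distance. If a derivative of order t < s of f is nonzero at w, the degree-t part of f(w + Y) is
nonzero, and by Schwartz–Zippel it is nonzero in at least a fraction 1 - s/q of the directions v. On
each such line f agrees to order s with a nonzero g of degree below qs - r, which has too few zeros
of multiplicity s to vanish at most points. Double counting pairs (direction, parameter) gives
`card_derivVec_ne_zero`.

The third claim is an exact formula for the quotient, since the ceiling in Δ_min equals ⌊r/s⌋. -/

noncomputable section

namespace LiftedMult

open scoped Matrix

/-! ### Perron–Frobenius for nonnegative matrices -/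

section Perron

variable {ι : Type*} [Fintype ι]

lemma mulVec_pos_of_pos {P : Matrix ι ι ℝ} (hP : ∀ i j, 0 < P i j) {x : ι → ℝ}
    (hx : ∀ i, 0 ≤ x i) (hx0 : x ≠ 0) (i : ι) : 0 < (P *ᵥ x) i := by
  obtain ⟨j, hj⟩ := Function.ne_iff.1 hx0
  exact Finset.sum_pos' (fun k _ => mul_nonneg (hP i k).le (hx k))
    ⟨j, Finset.mem_univ _, mul_pos (hP i j) ((hx j).lt_of_ne' hj)⟩

/-- The Collatz–Wielandt set: pairs `(μ, x)` with `x` in the simplex and `μ x ≤ B x`. -/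
def collatzWielandt (B : Matrix ι ι ℝ) : Set (ℝ × (ι → ℝ)) :=
  {p | 0 ≤ p.1 ∧ p.2 ∈ stdSimplex ℝ ι ∧ ∀ i, p.1 * p.2 i ≤ (B *ᵥ p.2) i}

/-- Boundedness of μ comes from summing the inequalities over i, as x has total mass one. -/
lemma isCompact_collatzWielandt {B : Matrix ι ι ℝ} (hB : ∀ i j, 0 ≤ B i j) :
    IsCompact (collatzWielandt B) := by
  have hsub : collatzWielandt B ⊆ Set.Icc 0 (∑ i, ∑ j, B i j) ×ˢ stdSimplex ℝ ι := by
    rintro ⟨μ, x⟩ ⟨h0, hx, h⟩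
    refine ⟨⟨h0, ?_⟩, hx⟩
    have hle : ∀ j, x j ≤ 1 := fun j => by
      rw [← hx.2]; exact Finset.single_le_sum (fun i _ => hx.1 i) (Finset.mem_univ j)
    calc μ = ∑ i, μ * x i := by rw [← Finset.mul_sum, hx.2, mul_one]
      _ ≤ ∑ i, (B *ᵥ x) i := Finset.sum_le_sum fun i _ => h i
      _ ≤ ∑ i, ∑ j, B i j := Finset.sum_le_sum fun i _ => Finset.sum_le_sum fun j _ =>
          mul_le_of_le_one_right (hB i j) (hle j)
  refine (isCompact_Icc.prod (isCompact_stdSimplex ℝ ι)).of_isClosed_subset ?_ hsub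
  have hc : ∀ i, Continuous fun p : ℝ × (ι → ℝ) => (B *ᵥ p.2) i := fun i => by
    unfold Matrix.mulVec dotProduct; fun_prop
  have : collatzWielandt B = {p | 0 ≤ p.1} ∩ (Prod.snd ⁻¹' stdSimplex ℝ ι ∩
      ⋂ i, {p | p.1 * p.2 i ≤ (B *ᵥ p.2) i}) := by
    ext p; simp [collatzWielandt]
  rw [this]
  refine (isClosed_le continuous_const continuous_fst).inter
    (((isClosed_stdSimplex (𝕜 := ℝ) (ι := ι)).preimage continuous_snd).inter
      (isClosed_iInter fun i => ?_))
  exact isClosed_le (by fun_prop) (hc i)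

/-- Perron–Frobenius: a nonnegative matrix `B` with `(1 + B) ^ N` positive has a positive
eigenvector. -/
theorem exists_pos_eigenvector [DecidableEq ι] [Nonempty ι] {B : Matrix ι ι ℝ}
    (hB : ∀ i j, 0 ≤ B i j) {N : ℕ} (hN : ∀ i j, 0 < ((1 + B) ^ N) i j) :
    ∃ μ : ℝ, 0 ≤ μ ∧ ∃ x : ι → ℝ, (∀ i, 0 < x i) ∧ B *ᵥ x = μ • x := by
  obtain ⟨i₀⟩ := ‹Nonempty ι›
  have hne : (collatzWielandt B).Nonempty :=
    ⟨(0, Pi.single i₀ 1), le_rfl, single_mem_stdSimplex ℝ i₀, fun i => by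
      simpa using hB i i₀⟩
  obtain ⟨⟨μ, x⟩, ⟨hμ, hx, hle⟩, hmax⟩ :=
    (isCompact_collatzWielandt hB).exists_isMaxOn hne continuous_fst.continuousOn
  simp only at hμ hx hle
  have hx0 : x ≠ 0 := by
    rintro rfl; simpa using hx.2
  have hcomm : Commute ((1 + B) ^ N) B :=
    ((Commute.one_left B).add_left (Commute.refl B)).pow_left N
  have heig : B *ᵥ x = μ • x := by
    by_contra hcon
    set P := (1 + B) ^ N
    -- P spreads the nonzero slack d to every coordinate and commutes with B, so y = P x satisfies B
    -- y ≥ (μ + ε) y with ε > 0, against the maximality of μ.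
    set d := B *ᵥ x - μ • x with hd
    have hd0 : d ≠ 0 := sub_ne_zero.2 hcon
    have hPd := mulVec_pos_of_pos hN (x := d) (fun i => by simpa [hd] using hle i) hd0
    have hPx := mulVec_pos_of_pos hN hx.1 hx0
    have hkey : B *ᵥ (P *ᵥ x) = μ • (P *ᵥ x) + P *ᵥ d := by
      rw [hd, Matrix.mulVec_sub, Matrix.mulVec_smul, Matrix.mulVec_mulVec, Matrix.mulVec_mulVec,
        hcomm.eq]
      abel
    set y := P *ᵥ x
    obtain ⟨k, -, hk⟩ := Finset.exists_min_image Finset.univ (fun i => (P *ᵥ d) i / y i)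
      ⟨i₀, Finset.mem_univ _⟩
    set ε := (P *ᵥ d) k / y k
    have hε : 0 < ε := div_pos (hPd k) (hPx k)
    have hS : 0 < ∑ i, y i := Finset.sum_pos (fun i _ => hPx i) ⟨i₀, Finset.mem_univ _⟩
    have hmem : (μ + ε, (∑ i, y i)⁻¹ • y) ∈ collatzWielandt B := by
      refine ⟨by positivity, ⟨fun i => ?_, ?_⟩, fun i => ?_⟩
      · exact mul_nonneg (inv_nonneg.2 hS.le) (hPx i).le
      · simp only [Pi.smul_apply, smul_eq_mul, ← Finset.mul_sum]
        exact inv_mul_cancel₀ hS.ne'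
      · have h1 : ε * y i ≤ (P *ᵥ d) i := (le_div_iff₀ (hPx i)).1 (hk i (Finset.mem_univ _))
        have h2 : (μ + ε) * y i ≤ (B *ᵥ y) i := by
          rw [hkey]; simp only [Pi.add_apply, Pi.smul_apply, smul_eq_mul]; linarith
        simp only [Matrix.mulVec_smul, Pi.smul_apply, smul_eq_mul]
        calc (μ + ε) * ((∑ i, y i)⁻¹ * y i) = (∑ i, y i)⁻¹ * ((μ + ε) * y i) := by ring
          _ ≤ _ := mul_le_mul_of_nonneg_left h2 (inv_nonneg.2 hS.le)
    have := hmax hmem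
    simp only [Set.mem_ofPred_eq] at this
    linarith
  refine ⟨μ, hμ, x, fun i => ?_, heig⟩
  have hpow : ∀ n : ℕ, (1 + B) ^ n *ᵥ x = (1 + μ) ^ n • x := by
    intro n
    induction n with
    | zero => simp
    | succ n ih =>
      rw [pow_succ', ← Matrix.mulVec_mulVec, ih, Matrix.mulVec_smul, Matrix.add_mulVec, heig,
        Matrix.one_mulVec, pow_succ, mul_smul, add_smul, one_smul]
  have := mulVec_pos_of_pos hN hx.1 hx0 i
  rw [hpow] at this
  exact pos_of_mul_pos_right this (by positivity)

/-- Entries of the power are sums over walks of N steps, and a walk that stays or moves to a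
neighbour reaches any index within distance N. -/
lemma pow_pos_of_dist {n : ℕ} {B : Matrix (Fin n) (Fin n) ℝ} (hB : ∀ i j, 0 ≤ B i j)
    (hB1 : ∀ i j : Fin n, (i : ℕ) + 1 = j → 0 < B i j ∧ 0 < B j i) (N : ℕ) :
    ∀ i j : Fin n, (i : ℕ) ≤ j + N → (j : ℕ) ≤ i + N → 0 < ((1 + B) ^ N) i j := by
  have hnn : ∀ i j, 0 ≤ (1 + B) i j := fun i j => by
    rw [Matrix.add_apply, Matrix.one_apply]
    exact add_nonneg (by split_ifs <;> norm_num) (hB i j)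
  have hdiag : ∀ i, 0 < (1 + B) i i := fun i => by
    simpa using add_pos_of_pos_of_nonneg one_pos (hB i i)
  have hpow : ∀ (N : ℕ) (i j : Fin n), 0 ≤ ((1 + B) ^ N) i j := by
    intro N
    induction N with
    | zero => intro i j; rw [pow_zero, Matrix.one_apply]; split_ifs <;> norm_num
    | succ N ih =>
      intro i j
      rw [pow_succ, Matrix.mul_apply]
      exact Finset.sum_nonneg fun k _ => mul_nonneg (ih i k) (hnn k j)
  induction N with
  | zero =>
    intro i j h1 h2
    have : i = j := Fin.ext (by omega)
    simp [this]
  | succ N ih =>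
    intro i j h1 h2
    have key : ∀ k : Fin n, 0 < ((1 + B) ^ N) i k → 0 < (1 + B) k j →
        0 < ((1 + B) ^ (N + 1)) i j := fun k hk1 hk2 => by
      rw [pow_succ, Matrix.mul_apply]
      exact Finset.sum_pos' (fun k _ => mul_nonneg (hpow N i k) (hnn k j))
        ⟨k, Finset.mem_univ _, mul_pos hk1 hk2⟩
    rcases lt_trichotomy (i : ℕ) j with h | h | h
    · refine key ⟨j - 1, by omega⟩ (ih _ _ (by simp only; omega) (by simp only; omega)) ?_
      rw [Matrix.add_apply, Matrix.one_apply]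
      exact add_pos_of_nonneg_of_pos (by split_ifs <;> norm_num)
        (hB1 ⟨j - 1, by omega⟩ j (by simp only; omega)).1
    · exact key j (ih _ _ (by omega) (by omega)) (hdiag j)
    · refine key ⟨j + 1, by omega⟩ (ih _ _ (by simp only; omega) (by simp only; omega)) ?_
      rw [Matrix.add_apply, Matrix.one_apply]
      exact add_pos_of_nonneg_of_pos (by split_ifs <;> norm_num)
        (hB1 j ⟨j + 1, by omega⟩ (by simp only)).2

end Perron

/-! ### Growth of the powers of A_m -/

lemma matA_nonneg (m : ℕ) (i j : Fin m) : 0 ≤ matA m i j := by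
  simp only [matA, Matrix.of_apply]
  split_ifs
  · exact Finset.sum_nonneg fun _ _ => Nat.cast_nonneg _
  · exact Nat.cast_nonneg _
  · exact le_rfl

lemma matA_pow_nonneg (m n : ℕ) (i j : Fin m) : 0 ≤ (matA m ^ n) i j := by
  induction n generalizing j with
  | zero => rw [pow_zero, Matrix.one_apply]; split_ifs <;> norm_num
  | succ n ih =>
    rw [pow_succ, Matrix.mul_apply]
    exact Finset.sum_nonneg fun k _ => mul_nonneg (ih k) (matA_nonneg m k j)

/-- This row makes the matrix block triangular, so positivity of a power can only be asked of the
leading block. -/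
lemma matA_last_row {n : ℕ} (k : Fin (n + 2)) :
    matA (n + 2) (Fin.last (n + 1)) k = if k = Fin.last (n + 1) then 1 else 0 := by
  simp only [matA, Matrix.of_apply, Fin.val_last]
  split_ifs with h1 h2 h2 h3 h3
  · rw [h2] at h1; simp at h1
  · rw [Finset.Icc_eq_empty (by omega)]; simp
  · rw [h3]
    have : 2 * (n + 1) + 1 - ((Fin.last (n + 1) : Fin (n + 2)) : ℕ) = n + 2 := by
      rw [Fin.val_last]; omega
    rw [this]; simp
  · have : (k : ℕ) < n + 1 := Fin.val_lt_last h3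
    rw [Nat.choose_eq_zero_of_lt (by omega)]; simp
  · rw [h3, Fin.val_last] at h2; omega
  · rfl

lemma matA_castSucc_succ {n : ℕ} (i j : Fin (n + 1)) (h : (i : ℕ) + 1 = j) :
    0 < matA (n + 2) i.castSucc j.castSucc ∧ 0 < matA (n + 2) j.castSucc i.castSucc := by
  have hi := i.isLt
  have hj := j.isLt
  simp only [matA, Matrix.of_apply, Fin.val_castSucc]
  constructor
  · rw [if_neg (by omega), if_pos (by omega)]
    exact_mod_cast Nat.choose_pos (by omega)
  · by_cases hi0 : (i : ℕ) = 0
    · rw [if_pos hi0]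
      refine Finset.sum_pos (fun k hk => ?_) ⟨n + 2, Finset.mem_Icc.2 ⟨by omega, le_rfl⟩⟩
      exact_mod_cast Nat.choose_pos (Finset.mem_Icc.1 hk).2
    · rw [if_neg hi0, if_pos (by omega)]
      exact_mod_cast Nat.choose_pos (by omega)

/-- `A_m` has an eigenvalue `μ > 0` bounding the growth of the first row of its powers. -/
theorem exists_eigenvalue_growth (m : ℕ) (hm : 1 ≤ m) :
    ∃ μ : ℝ, 0 < μ ∧ μ ∈ eigenvaluesA m ∧ ∃ K : ℝ, 0 < K ∧
      ∀ (n : ℕ) (j : Fin m), (matA m ^ n) ⟨0, hm⟩ j ≤ K * μ ^ n := by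
  obtain _ | _ | n := m
  · omega
  · have h1 : matA 1 = 1 := by
      ext i j
      fin_cases i; fin_cases j
      simp [matA]
    refine ⟨1, one_pos, ?_, 1, one_pos, fun n j => ?_⟩
    · rw [eigenvaluesA, Set.mem_ofPred_eq, zero_add, h1]
      refine Module.End.hasEigenvalue_of_hasEigenvector (x := fun _ => 1) ⟨?_, ?_⟩
      · rw [Module.End.mem_eigenspace_iff]; simp
      · intro h; simpa using congrFun h 0
    · fin_cases j; simp [h1]
  set A := matA (n + 2) with hA
  obtain ⟨μ, hμ0, x, hx, hBx⟩ := exists_pos_eigenvector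
    (B := A.submatrix (Fin.castSucc : Fin (n + 1) → _) Fin.castSucc)
    (fun i j => matA_nonneg _ _ _) (N := n + 1)
    (fun i j => pow_pos_of_dist (fun i j => matA_nonneg _ _ _)
      (fun i j h => matA_castSucc_succ i j h) _ i j (by omega) (by omega))
  -- Padding the Perron vector by zero keeps it an eigenvector because the last row vanishes off the
  -- diagonal. It controls every column but the last.
  set v : Fin (n + 2) → ℝ := Fin.snoc x 0 with hv
  have hvl : v (Fin.last _) = 0 := by simp [hv]
  have hvc : ∀ i : Fin (n + 1), v i.castSucc = x i := fun i => by simp [hv]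
  have hAv : A *ᵥ v = μ • v := by
    ext j
    simp only [Matrix.mulVec, dotProduct, Pi.smul_apply, smul_eq_mul]
    rw [Fin.sum_univ_castSucc, hvl, mul_zero, add_zero]
    refine Fin.lastCases ?_ (fun i => ?_) j
    · rw [hvl, mul_zero]
      refine Finset.sum_eq_zero fun i _ => ?_
      rw [hA, matA_last_row, if_neg (Fin.castSucc_lt_last i).ne, zero_mul]
    · rw [hvc]
      simp only [hvc]
      exact congrFun hBx i
  have hv0 : 0 < v 0 := by rw [← Fin.castSucc_zero, hvc]; exact hx 0
  have hvnn : ∀ i, 0 ≤ v i := fun i => by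
    refine Fin.lastCases ?_ (fun i => ?_) i
    · rw [hvl]
    · rw [hvc]; exact (hx i).le
  have hAnn : ∀ n i j, 0 ≤ (A ^ n) i j := fun n i j => matA_pow_nonneg _ n i j
  -- The corner entry 1 gives a recursion of the form a_(k+1) ≤ a_k + L μ^k for the last column; μ ≥
  -- 2 makes this compatible with a_k ≤ L μ^k.
  have hμ2 : 2 ≤ μ := by
    have h1 : A 0 0 * v 0 ≤ μ * v 0 := by
      have := congrFun hAv 0
      simp only [Matrix.mulVec, dotProduct, Pi.smul_apply, smul_eq_mul] at this
      rw [← this]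
      exact Finset.single_le_sum (f := fun k => A 0 k * v k)
        (fun k _ => mul_nonneg (matA_nonneg _ _ _) (hvnn k)) (Finset.mem_univ 0)
    have h2 : (2 : ℝ) ≤ A 0 0 := by
      have : (((n + 2).choose 1 : ℕ) : ℝ) ≤ A 0 0 := by
        simp only [hA, matA, Matrix.of_apply, Fin.val_zero, if_true]
        exact Finset.single_le_sum (f := fun i => (((n + 2).choose i : ℕ) : ℝ))
          (fun _ _ => Nat.cast_nonneg _) (Finset.mem_Icc.2 ⟨le_rfl, by omega⟩)
      rw [Nat.choose_one_right] at this
      push_cast at this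
      linarith [(Nat.cast_nonneg n : (0 : ℝ) ≤ n)]
    exact h2.trans (le_of_mul_le_mul_right h1 hv0)
  have hpow : ∀ k : ℕ, A ^ k *ᵥ v = μ ^ k • v := by
    intro k
    induction k with
    | zero => simp
    | succ k ih =>
      rw [pow_succ, ← Matrix.mulVec_mulVec, hAv, Matrix.mulVec_smul, ih, smul_smul, pow_succ']
  obtain ⟨K, hK0, hK⟩ : ∃ K : ℝ, 0 < K ∧ ∀ (k : ℕ) (j : Fin (n + 1)),
      (A ^ k) 0 j.castSucc ≤ K * μ ^ k := by
    refine ⟨∑ j, v 0 / x j, Finset.sum_pos (fun j _ => div_pos hv0 (hx j)) ⟨0, Finset.mem_univ _⟩,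
      fun k j => ?_⟩
    have h1 : (A ^ k) 0 j.castSucc * x j ≤ μ ^ k * v 0 := by
      have := congrFun (hpow k) 0
      simp only [Matrix.mulVec, dotProduct, Pi.smul_apply, smul_eq_mul] at this
      rw [← this, ← hvc]
      exact Finset.single_le_sum (f := fun i => (A ^ k) 0 i * v i)
        (fun i _ => mul_nonneg (hAnn _ _ _) (hvnn i)) (Finset.mem_univ _)
    calc (A ^ k) 0 j.castSucc ≤ v 0 / x j * μ ^ k := by
          rw [div_mul_eq_mul_div, le_div_iff₀ (hx j), mul_comm (v 0)]; exact h1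
      _ ≤ _ := mul_le_mul_of_nonneg_right
          (Finset.single_le_sum (f := fun j => v 0 / x j)
            (fun i _ => (div_pos hv0 (hx i)).le) (Finset.mem_univ j)) (by positivity)
  set L := K * ∑ i : Fin (n + 1), A i.castSucc (Fin.last _) with hL
  have hL0 : 0 ≤ L := mul_nonneg hK0.le (Finset.sum_nonneg fun i _ => matA_nonneg _ _ _)
  have hlast : ∀ k : ℕ, (A ^ k) 0 (Fin.last _) ≤ L * μ ^ k := by
    intro k
    induction k with
    | zero =>
      rw [pow_zero, Matrix.one_apply, if_neg (by simp [Fin.ext_iff])]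
      positivity
    | succ k ih =>
      rw [pow_succ, Matrix.mul_apply, Fin.sum_univ_castSucc, hA, matA_last_row, if_pos rfl, mul_one,
        ← hA]
      have h1 : ∑ i : Fin (n + 1), (A ^ k) 0 i.castSucc * A i.castSucc (Fin.last _) ≤ L * μ ^ k := by
        rw [hL, mul_right_comm, Finset.mul_sum]
        exact Finset.sum_le_sum fun i _ => mul_le_mul_of_nonneg_right (hK k i) (matA_nonneg _ _ _)
      have h2 : 0 ≤ L * μ ^ k := by positivity
      calc _ ≤ L * μ ^ k * 2 := by linarith
        _ ≤ L * μ ^ k * μ := mul_le_mul_of_nonneg_left hμ2 h2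
        _ = _ := by ring
  refine ⟨μ, by linarith, ?_, K + L, by linarith, fun k j => ?_⟩
  · refine Module.End.hasEigenvalue_of_hasEigenvector (x := v) ⟨?_, ?_⟩
    · rw [Module.End.mem_eigenspace_iff, Matrix.toLin'_apply, hAv]
    · intro h; rw [h] at hv0; exact lt_irrefl _ hv0
  · have hp : 0 < μ ^ k := pow_pos (by linarith) k
    refine Fin.lastCases ((hlast k).trans ?_) (fun i => (hK k i).trans ?_) j <;>
      exact mul_le_mul_of_nonneg_right (by linarith) hp.le

/-- The spectrum is finite, so one real eigenvalue, supplied by Perron–Frobenius, suffices. -/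
theorem isGreatest_topEigenvalue (m : ℕ) (hm : 1 ≤ m) :
    IsGreatest (eigenvaluesA m) (topEigenvalue m) := by
  obtain ⟨μ, -, hμ, -⟩ := exists_eigenvalue_growth m hm
  have hfin : (eigenvaluesA m).Finite :=
    Module.End.finite_hasEigenvalue (Matrix.toLin' (matA m))
  exact ⟨Set.Nonempty.csSup_mem ⟨μ, hμ⟩ hfin, fun x hx => le_csSup hfin.bddAbove hx⟩

/-! ### Counting exponents by binary carries -/

/-- Lucas modulo 2: the binary digits of e lie under those of b. -/
lemma odd_choose_div_mod {b e : ℕ} (h : Odd (b.choose e)) :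
    e % 2 ≤ b % 2 ∧ Odd ((b / 2).choose (e / 2)) := by
  have hl := Choose.choose_modEq_choose_mod_mul_choose_div_nat (n := b) (k := e) (p := 2)
  have hodd : Odd ((b % 2).choose (e % 2) * (b / 2).choose (e / 2)) := by
    rw [Nat.odd_iff] at h ⊢; exact Eq.trans hl.symm h
  rw [Nat.odd_mul] at hodd
  refine ⟨?_, hodd.2⟩
  by_contra hlt
  rw [Nat.choose_eq_zero_of_lt (not_le.1 hlt)] at hodd
  simp at hodd

lemma odd_choose_div_pow {b e : ℕ} (h : Odd (b.choose e)) (k : ℕ) :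
    Odd ((b / 2 ^ k).choose (e / 2 ^ k)) := by
  induction k with
  | zero => simpa using h
  | succ k ih =>
    rw [pow_succ, ← Nat.div_div_eq_div_mul, ← Nat.div_div_eq_div_mul]
    exact (odd_choose_div_mod ih).2

/-- The box `[0, N) ^ m`. -/
def box (m N : ℕ) : Finset (Fin m → ℕ) := Fintype.piFinset fun _ => Finset.range N

lemma mem_box {m N : ℕ} {b : Fin m → ℕ} : b ∈ box m N ↔ ∀ j, b j < N := by
  simp [box]

lemma card_box (m N : ℕ) : (box m N).card = N ^ m := by
  simp [box]

open Classical in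
/-- Exponents `b < 2 ^ n` such that, for some `e` below `b` in binary and some carry `c ≤ C`,
the sum of the entries of `e` plus `c` is `-1` modulo `2 ^ n`. -/
def carrySet (m n C : ℕ) : Finset (Fin m → ℕ) :=
  (box m (2 ^ n)).filter fun b =>
    ∃ e : Fin m → ℕ, (∀ j, Odd ((b j).choose (e j))) ∧ ∃ c ≤ C, 2 ^ n ∣ ∑ j, e j + c + 1

lemma mem_carrySet {m n C : ℕ} {b : Fin m → ℕ} : b ∈ carrySet m n C ↔ (∀ j, b j < 2 ^ n) ∧
    ∃ e : Fin m → ℕ, (∀ j, Odd ((b j).choose (e j))) ∧ ∃ c ≤ C, 2 ^ n ∣ ∑ j, e j + c + 1 := by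
  simp [carrySet, mem_box]

lemma carrySet_subset_box (m n C : ℕ) : carrySet m n C ⊆ box m (2 ^ n) := fun _ hb =>
  mem_box.2 (mem_carrySet.1 hb).1

/-- The low bits of e and the incoming carry must add up to an odd number 2c' + 1, and c' is the
outgoing carry. At most as many low bits are set in e as in b. -/
lemma halve_mem_carrySet {m n C : ℕ} {b : Fin m → ℕ} (hb : b ∈ carrySet m (n + 1) C) :
    1 ≤ C + (Finset.univ.filter fun j => b j % 2 = 1).card ∧
      (fun j => b j / 2) ∈
        carrySet m n ((C + (Finset.univ.filter fun j => b j % 2 = 1).card - 1) / 2) := by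
  obtain ⟨hlt, e, he, c, hc, hdvd⟩ := mem_carrySet.1 hb
  have hsum : ∑ j, e j = 2 * ∑ j, e j / 2 + ∑ j, e j % 2 := by
    rw [Finset.mul_sum, ← Finset.sum_add_distrib]
    exact Finset.sum_congr rfl fun j _ => (Nat.div_add_mod _ _).symm
  have hle : ∑ j, e j % 2 ≤ (Finset.univ.filter fun j => b j % 2 = 1).card := by
    rw [Finset.card_filter]
    refine Finset.sum_le_sum fun j _ => ?_
    have := (odd_choose_div_mod (he j)).1
    split_ifs <;> omega
  have h2 : 2 ∣ ∑ j, e j + c + 1 := (Dvd.intro_left (2 ^ n) (pow_succ 2 n).symm).trans hdvd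
  obtain ⟨c', hc'⟩ : ∃ c', ∑ j, e j % 2 + c = 2 * c' + 1 := ⟨(∑ j, e j % 2 + c) / 2, by omega⟩
  refine ⟨by omega, mem_carrySet.2 ⟨fun j => ?_, fun j => e j / 2,
    fun j => (odd_choose_div_mod (he j)).2, c', by omega, ?_⟩⟩
  · have := hlt j
    rw [pow_succ] at this
    omega
  · have h3 : ∑ j, e j + c + 1 = 2 * (∑ j, e j / 2 + c' + 1) := by omega
    rw [h3, pow_succ'] at hdvd
    exact Nat.dvd_of_mul_dvd_mul_left two_pos hdvd

lemma card_carrySet_succ (m n C : ℕ) :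
    (carrySet m (n + 1) C).card ≤ ∑ β : Finset (Fin m),
      if 1 ≤ C + β.card then (carrySet m n ((C + β.card - 1) / 2)).card else 0 := by
  classical
  rw [Finset.card_eq_sum_card_fiberwise (t := Finset.univ)
    (f := fun b : Fin m → ℕ => Finset.univ.filter fun j => b j % 2 = 1)
    (fun _ _ => Finset.mem_coe.2 (Finset.mem_univ _))]
  refine Finset.sum_le_sum fun β _ => ?_
  split_ifs with h
  · refine Finset.card_le_card_of_injOn (fun b j => b j / 2) (fun b hb => ?_) ?_
    · obtain ⟨hmem, rfl⟩ := Finset.mem_filter.1 (Finset.mem_coe.1 hb)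
      exact (halve_mem_carrySet hmem).2
    · intro b hb b' hb' heq
      have h1 := (Finset.mem_filter.1 hb).2
      have h2 := (Finset.mem_filter.1 hb').2
      funext j
      have h3 := congrFun heq j
      have h4 : b j % 2 = 1 ↔ b' j % 2 = 1 := by
        have := congrArg (j ∈ ·) (h1.trans h2.symm)
        simpa using this
      simp only at h3
      omega
  · rw [Nat.le_zero, Finset.card_eq_zero, Finset.filter_eq_empty_iff]
    rintro b hb rfl
    exact h (halve_mem_carrySet hb).1

/-- Column 0 is the case C = 0, and raising C to C + 1 admits the subsets of size 2j - C, which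
column C + 1 counts. As 2j + 1 ≤ C + |β| means j ≤ ⌊(C + |β| - 1)/2⌋ for C + |β| ≥ 1, A_m is the
recursion of `card_carrySet_succ` in increments of C. -/
lemma sum_matA_row (m C : ℕ) (hm : 1 ≤ m) (hC : C < m) (j : Fin m) :
    ∑ k : Fin m, (if (k : ℕ) ≤ C then matA m j k else 0) =
      ∑ β : Finset (Fin m), if 2 * (j : ℕ) + 1 ≤ C + β.card then (1 : ℝ) else 0 := by
  have hβ : ∑ β : Finset (Fin m), (if 2 * (j : ℕ) + 1 ≤ C + β.card then (1 : ℝ) else 0) =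
      ∑ i ∈ Finset.range (m + 1), if 2 * (j : ℕ) + 1 ≤ C + i then (m.choose i : ℝ) else 0 := by
    have := Finset.sum_powerset_apply_card (x := (Finset.univ : Finset (Fin m)))
      (fun i => if 2 * (j : ℕ) + 1 ≤ C + i then (1 : ℝ) else 0)
    rw [Finset.powerset_univ, Finset.card_univ, Fintype.card_fin] at this
    rw [this]
    refine Finset.sum_congr rfl fun i _ => ?_
    simp
  rw [hβ]
  clear hβ
  induction C with
  | zero =>
    rw [Finset.sum_eq_single ⟨0, hm⟩]
    · simp only [matA, Matrix.of_apply, le_refl, if_true, zero_add]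
      rw [← Finset.sum_filter]
      refine Finset.sum_congr ?_ fun _ _ => rfl
      ext i; simp only [Finset.mem_Icc, Finset.mem_filter, Finset.mem_range]; omega
    · intro k _ hk
      rw [if_neg]
      rw [Ne, Fin.ext_iff] at hk
      simp only at hk; omega
    · simp
  | succ C ih =>
    have h1 : ∀ k : Fin m, (if (k : ℕ) ≤ C + 1 then matA m j k else 0) =
        (if (k : ℕ) ≤ C then matA m j k else 0) +
          if k = ⟨C + 1, hC⟩ then matA m j k else 0 := fun k => by
      have : k = ⟨C + 1, hC⟩ ↔ (k : ℕ) = C + 1 := Fin.ext_iff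
      simp only [this]
      split_ifs <;> first | omega | simp
    have h2 : ∀ i : ℕ, (if 2 * (j : ℕ) + 1 ≤ C + 1 + i then (m.choose i : ℝ) else 0) =
        (if 2 * (j : ℕ) + 1 ≤ C + i then (m.choose i : ℝ) else 0) +
          if i + (C + 1) = 2 * (j : ℕ) + 1 then (m.choose i : ℝ) else 0 := fun i => by
      split_ifs <;> first | omega | simp
    simp only [h1, h2, Finset.sum_add_distrib]
    rw [ih (by omega)]
    congr 1
    rw [Finset.sum_ite_eq' Finset.univ, if_pos (Finset.mem_univ _)]
    simp only [matA, Matrix.of_apply, Nat.succ_ne_zero, if_false]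
    split_ifs with h
    · rw [Finset.sum_eq_single (2 * (j : ℕ) + 1 - (C + 1))]
      · rw [if_pos (by omega)]
      · intro i _ hi; rw [if_neg (by omega)]
      · intro hi
        rw [Nat.choose_eq_zero_of_lt (by rw [Finset.mem_range] at hi; omega)]
        simp
    · refine (Finset.sum_eq_zero fun i _ => ?_).symm
      rw [if_neg (by omega)]

theorem card_carrySet_le (m n C : ℕ) (hm : 1 ≤ m) (hC : C < m) :
    ((carrySet m n C).card : ℝ) ≤
      ∑ k : Fin m, if (k : ℕ) ≤ C then (matA m ^ n) ⟨0, hm⟩ k else 0 := by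
  induction n generalizing C with
  | zero =>
    have h1 : (carrySet m 0 C).card ≤ 1 := by
      calc _ ≤ (box m (2 ^ 0)).card := Finset.card_le_card (carrySet_subset_box m 0 C)
        _ = 1 := by rw [card_box]; simp
    rw [Finset.sum_eq_single ⟨0, hm⟩]
    · simpa using h1
    · intro k _ hk
      rw [pow_zero, Matrix.one_apply_ne hk.symm, ite_self]
    · simp
  | succ n ih =>
    have h1 : ((carrySet m (n + 1) C).card : ℝ) ≤ ∑ β : Finset (Fin m),
        ∑ j : Fin m, if 2 * (j : ℕ) + 1 ≤ C + β.card then (matA m ^ n) ⟨0, hm⟩ j else 0 := by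
      refine (Nat.cast_le.2 (card_carrySet_succ m n C)).trans ?_
      rw [Nat.cast_sum]
      refine Finset.sum_le_sum fun β _ => ?_
      have hβ : β.card ≤ m := by simpa using Finset.card_le_univ β
      split_ifs with h
      -- From C < m and |β| ≤ m the new carry bound is again below m.
      · refine (ih _ (by omega)).trans (le_of_eq (Finset.sum_congr rfl fun j _ => ?_))
        refine if_congr ?_ rfl rfl
        omega
      · rw [Nat.cast_zero]
        exact Finset.sum_nonneg fun j _ => by
          split_ifs
          · exact matA_pow_nonneg _ _ _ _
          · exact le_rfl
    refine h1.trans (le_of_eq ?_)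
    have h2 : ∀ k : Fin m, (if (k : ℕ) ≤ C then (matA m ^ (n + 1)) ⟨0, hm⟩ k else 0) =
        ∑ j, (matA m ^ n) ⟨0, hm⟩ j * if (k : ℕ) ≤ C then matA m j k else 0 := fun k => by
      split_ifs
      · rw [pow_succ, Matrix.mul_apply]
      · simp
    simp only [h2]
    refine Finset.sum_comm.trans (Eq.trans ?_ Finset.sum_comm)
    refine Finset.sum_congr rfl fun j _ => ?_
    rw [← Finset.mul_sum, sum_matA_row m C hm hC, Finset.mul_sum]
    exact Finset.sum_congr rfl fun β _ => by simp

/-! ### Bad exponents -/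

open Classical in
/-- Exponents `b < q` such that some `e` below `b` in binary has `|e| mod q + ⌊|e| / q⌋` at least
`q - r`. -/
def badSet (m q r : ℕ) : Finset (Fin m → ℕ) :=
  (box m q).filter fun b => ∃ e : Fin m → ℕ, (∀ j, Odd ((b j).choose (e j))) ∧
    q - r ≤ (∑ j, e j) % q + (∑ j, e j) / q

lemma mem_badSet {m q r : ℕ} {b : Fin m → ℕ} : b ∈ badSet m q r ↔ (∀ j, b j < q) ∧
    ∃ e : Fin m → ℕ, (∀ j, Odd ((b j).choose (e j))) ∧
      q - r ≤ (∑ j, e j) % q + (∑ j, e j) / q := by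
  simp [badSet, mem_box]

lemma sum_le_of_odd_choose {m q : ℕ} (hq : 1 ≤ q) {b e : Fin m → ℕ} (hb : ∀ j, b j < q)
    (he : ∀ j, Odd ((b j).choose (e j))) : ∑ j, e j ≤ m * (q - 1) := by
  calc ∑ j, e j ≤ ∑ _j : Fin m, (q - 1) := Finset.sum_le_sum fun j _ => by
        have h1 : e j ≤ b j := by
          by_contra hlt
          have := he j
          rw [Nat.choose_eq_zero_of_lt (not_le.1 hlt)] at this
          simp at this
        have := hb j
        omega
    _ = _ := by simp

/-- For N = |e| the quotient N/q is at most m - 1, so badness gives N mod q ≥ q - 2^ρ: its digits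
from position ρ on are all 1, that is, ⌊N/2^ρ⌋ ≡ -1 modulo 2^(l-ρ). The m discarded low parts send
up a carry of at most m - 1. For ρ = l the modulus is 1. -/
lemma div_pow_mem_carrySet {m l ρ r : ℕ} (hm : 1 ≤ m) (hρl : ρ ≤ l)
    (hρ : r + m ≤ 2 ^ ρ + 1 ∨ ρ = l) {b : Fin m → ℕ} (hb : b ∈ badSet m (2 ^ l) r) :
    (fun j => b j / 2 ^ ρ) ∈ carrySet m (l - ρ) (m - 1) := by
  obtain ⟨hbox, e, he, hbad⟩ := mem_badSet.1 hb
  obtain ⟨k, rfl⟩ := Nat.exists_eq_add_of_le hρl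
  rw [Nat.add_sub_cancel_left]
  set P := 2 ^ ρ with hP
  have hP0 : 0 < P := by positivity
  have hq : 2 ^ (ρ + k) = P * 2 ^ k := pow_add 2 ρ k
  have hsum : ∑ j, e j = P * ∑ j, e j / P + ∑ j, e j % P := by
    rw [Finset.mul_sum, ← Finset.sum_add_distrib]
    exact Finset.sum_congr rfl fun j _ => (Nat.div_add_mod _ _).symm
  have hlow : ∑ j, e j % P < m * P := by
    have : Nonempty (Fin m) := ⟨⟨0, hm⟩⟩
    calc ∑ j, e j % P < ∑ _j : Fin m, P :=
          Finset.sum_lt_sum_of_nonempty Finset.univ_nonempty fun j _ => Nat.mod_lt _ hP0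
      _ = _ := by simp
  refine mem_carrySet.2 ⟨fun j => ?_, fun j => e j / P, fun j => odd_choose_div_pow (he j) ρ,
    (∑ j, e j % P) / P, ?_, ?_⟩
  · refine Nat.div_lt_of_lt_mul ?_
    rw [← hq]; exact hbox j
  · have := (Nat.div_lt_iff_lt_mul hP0).2 hlow
    omega
  · have hdiv : ∑ j, e j / P + (∑ j, e j % P) / P = (∑ j, e j) / P := by
      rw [hsum, Nat.mul_add_div hP0]
    rw [hdiv]
    rcases hρ with hρ | hρ
    · set N := ∑ j, e j with hN
      have hN1 : N ≤ m * (2 ^ (ρ + k) - 1) := sum_le_of_odd_choose Nat.one_le_two_pow hbox he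
      have hq0 : 0 < 2 ^ (ρ + k) := by positivity
      have hNq : N / 2 ^ (ρ + k) < m := by
        rw [Nat.div_lt_iff_lt_mul hq0]
        refine hN1.trans_lt (Nat.mul_lt_mul_of_pos_left (by omega) (by omega))
      have h1 : 2 ^ (ρ + k) ≤ N % 2 ^ (ρ + k) + P := by omega
      set n₁ := N / 2 ^ (ρ + k)
      set n₀ := N % 2 ^ (ρ + k)
      have hNn : N = 2 ^ (ρ + k) * n₁ + n₀ := (Nat.div_add_mod _ _).symm
      have hn₀ : n₀ < 2 ^ (ρ + k) := Nat.mod_lt _ hq0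
      have h2 : N / P = 2 ^ k * n₁ + n₀ / P := by
        rw [hNn, hq, mul_assoc, Nat.mul_add_div hP0]
      have h3 : n₀ / P + 1 = 2 ^ k := by
        have ha : n₀ / P < 2 ^ k := Nat.div_lt_of_lt_mul (by rw [← hq]; exact hn₀)
        have hb : 2 ^ k ≤ (n₀ + P) / P := by
          rw [Nat.le_div_iff_mul_le hP0, mul_comm, ← hq]; exact h1
        rw [Nat.add_div_right _ hP0] at hb
        omega
      rw [h2, add_assoc, h3]
      exact ⟨n₁ + 1, by ring⟩
    · have : k = 0 := by omega
      simp [this]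

theorem card_badSet_le {m l ρ r : ℕ} (hm : 1 ≤ m) (hρl : ρ ≤ l)
    (hρ : r + m ≤ 2 ^ ρ + 1 ∨ ρ = l) :
    (badSet m (2 ^ l) r).card ≤ (2 ^ ρ) ^ m * (carrySet m (l - ρ) (m - 1)).card := by
  rw [← card_box m (2 ^ ρ), ← Finset.card_product]
  refine Finset.card_le_card_of_injOn (fun b => (fun j => b j % 2 ^ ρ, fun j => b j / 2 ^ ρ))
    (fun b hb => ?_) fun b _ b' _ h => ?_
  · exact Finset.mem_product.2 ⟨mem_box.2 fun j => Nat.mod_lt _ (by positivity),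
      div_pow_mem_carrySet hm hρl hρ hb⟩
  · rw [Prod.mk.injEq] at h
    funext j
    rw [← Nat.div_add_mod (b j) (2 ^ ρ), ← Nat.div_add_mod (b' j) (2 ^ ρ)]
    have h1 := congrFun h.1 j
    have h2 := congrFun h.2 j
    rw [h1, h2]

/-- The number of bad exponents grows like `μ ^ (l - ρ)` for an eigenvalue `μ` of `A_m`. -/
theorem exists_card_badSet_bound (m : ℕ) (hm : 1 ≤ m) :
    ∃ μ : ℝ, 0 < μ ∧ μ ∈ eigenvaluesA m ∧ ∃ K : ℝ, 0 < K ∧ ∀ l ρ r : ℕ, ρ ≤ l →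
      (r + m ≤ 2 ^ ρ + 1 ∨ ρ = l) →
      ((badSet m (2 ^ l) r).card : ℝ) ≤ K * ((2 ^ ρ) ^ m * μ ^ (l - ρ)) := by
  obtain ⟨μ, hμ0, hμ, K, hK0, hK⟩ := exists_eigenvalue_growth m hm
  have hm' : (0 : ℝ) < m := by exact_mod_cast hm
  refine ⟨μ, hμ0, hμ, m * K, by positivity, fun l ρ r hρl hρ => ?_⟩
  have h1 : ((carrySet m (l - ρ) (m - 1)).card : ℝ) ≤ m * (K * μ ^ (l - ρ)) := by
    refine (card_carrySet_le m _ _ hm (by omega)).trans ?_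
    calc _ ≤ ∑ _k : Fin m, K * μ ^ (l - ρ) := Finset.sum_le_sum fun k _ => by
          rw [if_pos (by omega)]; exact hK _ k
      _ = _ := by simp
  calc ((badSet m (2 ^ l) r).card : ℝ)
      ≤ (2 ^ ρ) ^ m * (carrySet m (l - ρ) (m - 1)).card := by
        exact_mod_cast card_badSet_le hm hρl hρ
    _ ≤ (2 ^ ρ) ^ m * (m * (K * μ ^ (l - ρ))) := by gcongr
    _ = _ := by ring

/-! ### Translation and restriction to lines -/

open MvPolynomial in
/-- The translate `f(w + Y)` of `f`. -/
def translate {m : ℕ} {F : Type*} [Field F] (w : Fin m → F) :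
    MvPolynomial (Fin m) F →ₐ[F] MvPolynomial (Fin m) F :=
  aeval fun j => C (w j) + X j

lemma derivVec_apply {m : ℕ} {F : Type*} [Field F] (s : ℕ) (f : MvPolynomial (Fin m) F)
    (w : Fin m → F) (i : {i : Fin m →₀ ℕ // i.degree < s}) :
    derivVec s f w i = (translate w f).coeff i.1 := by
  have h : MvPolynomial.map (MvPolynomial.eval w) (shift f) = translate w f := by
    induction f using MvPolynomial.induction_on with
    | C a =>
      simp only [shift, translate, MvPolynomial.algHom_C, MvPolynomial.algebraMap_eq]
      rw [MvPolynomial.algebraMap_apply, MvPolynomial.map_C, MvPolynomial.algebraMap_eq,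
        MvPolynomial.eval_C]
    | add p q hp hq =>
      simp only [shift, map_add] at hp hq ⊢
      rw [hp, hq]
    | mul_X p j hp =>
      simp only [shift, map_mul] at hp ⊢
      rw [hp]
      simp [translate]
  rw [← h, MvPolynomial.coeff_map]
  rfl

/-- `lineRestrict` as an algebra homomorphism. -/
def lineHom {m : ℕ} {F : Type*} [Field F] (w v : Fin m → F) :
    MvPolynomial (Fin m) F →ₐ[F] Polynomial F :=
  MvPolynomial.aeval fun j => Polynomial.C (w j) + Polynomial.C (v j) * Polynomial.X

lemma lineHom_apply {m : ℕ} {F : Type*} [Field F] (w v : Fin m → F)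
    (f : MvPolynomial (Fin m) F) : lineHom w v f = lineRestrict f w v := rfl

lemma derivVec_sub {m : ℕ} {F : Type*} [Field F] (s : ℕ) (f g : MvPolynomial (Fin m) F)
    (w : Fin m → F) : derivVec s (f - g) w = derivVec s f w - derivVec s g w := by
  funext i
  simp only [derivVec_apply, map_sub, MvPolynomial.coeff_sub, Pi.sub_apply]

open Polynomial in
lemma prod_linear_pow {m : ℕ} {F : Type*} [Field F] (b : Fin m → ℕ) (w v : Fin m → F) :
    ∏ j, (C (w j) + C (v j) * X) ^ b j =
      ∑ e ∈ Fintype.piFinset fun j => Finset.range (b j + 1),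
        ((∏ j, (b j).choose (e j) : ℕ) : F) •
          (C (∏ j, v j ^ e j * w j ^ (b j - e j)) * X ^ (∑ j, e j)) := by
  have h : ∀ j, (C (w j) + C (v j) * X) ^ b j = ∑ k ∈ Finset.range (b j + 1),
      (C (((b j).choose k : ℕ) : F)) * (C (v j ^ k * w j ^ (b j - k)) * X ^ k) := fun j => by
    rw [add_comm, add_pow]
    refine Finset.sum_congr rfl fun k _ => ?_
    simp only [mul_pow, map_mul, map_pow, map_natCast]
    ring
  simp only [h]
  rw [Finset.prod_univ_sum]
  refine Finset.sum_congr rfl fun e _ => ?_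
  rw [Finset.prod_mul_distrib, Finset.prod_mul_distrib, Finset.prod_pow_eq_pow_sum, ← map_prod,
    ← map_prod, smul_eq_C_mul, Nat.cast_prod]

/-! ### The basis adapted to T^q - T -/

section FiniteField

variable {F : Type*} [Field F] [Fintype F]

/-- The additive map `x ↦ x ^ q - x` on an algebra over the field `F` with `q` elements. -/
def frobSub (F : Type*) [Field F] [Fintype F] (R : Type*) [CommRing R] [Algebra F R] : R →ₗ[F] R :=
  (FiniteField.frobeniusAlgHom F R).toLinearMap - LinearMap.id

lemma frobSub_apply {R : Type*} [CommRing R] [Algebra F R] (x : R) :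
    frobSub F R x = x ^ Fintype.card F - x := rfl

lemma frobSub_algebraMap {R : Type*} [CommRing R] [Algebra F R] (x : F) :
    frobSub F R (algebraMap F R x) = 0 := by
  rw [frobSub_apply, ← map_pow, FiniteField.pow_card, sub_self]

lemma map_frobSub {R S : Type*} [CommRing R] [Algebra F R] [CommRing S] [Algebra F S]
    (φ : R →ₐ[F] S) (x : R) : φ (frobSub F R x) = frobSub F S (φ x) := by
  simp [frobSub_apply]

open Polynomial in
lemma taylor_frobSub (x : F) : taylor x (frobSub F F[X] X) = frobSub F F[X] X := by
  rw [← coe_taylorAlgHom]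
  change taylorAlgHom x _ = _
  rw [map_frobSub]
  change frobSub F F[X] (taylor x X) = _
  rw [taylor_X, map_add]
  rw [← algebraMap_eq, frobSub_algebraMap, add_zero]

open Polynomial in
lemma equivUpTo_of_dvd {s : ℕ} {f g : F[X]} (h : frobSub F F[X] X ^ s ∣ f - g) :
    EquivUpTo s f g := by
  intro k hk x
  rw [← taylor_coeff, ← taylor_coeff, ← sub_eq_zero, ← coeff_sub, ← map_sub]
  refine X_pow_dvd_iff.1 ?_ k hk
  obtain ⟨p, hp⟩ := h
  rw [hp, taylor_mul, taylor_pow, taylor_frobSub]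
  refine Dvd.dvd.mul_right (pow_dvd_pow_of_dvd ?_ s) _
  rw [frobSub_apply]
  exact dvd_sub (dvd_pow_self _ Fintype.card_ne_zero) dvd_rfl

open Polynomial in
/-- Polynomials congruent to one of degree `< d` modulo `(T ^ q - T) ^ s`. -/
def lowDegree (F : Type*) [Field F] [Fintype F] (s d : ℕ) : Submodule F F[X] :=
  degreeLT F d ⊔ (Ideal.span {frobSub F F[X] X ^ s}).restrictScalars F

open Polynomial in
lemma exists_equivUpTo_of_mem_lowDegree {s d : ℕ} {f : F[X]} (h : f ∈ lowDegree F s d) :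
    ∃ g : F[X], g.degree < (d : WithBot ℕ) ∧ EquivUpTo s f g := by
  obtain ⟨g, hg, p, hp, rfl⟩ := Submodule.mem_sup.1 h
  refine ⟨g, mem_degreeLT.1 hg, equivUpTo_of_dvd ?_⟩
  rw [add_sub_cancel_left]
  exact Ideal.mem_span_singleton.1 hp

open Polynomial in
lemma degree_frobSub_X : (frobSub F F[X] X).degree = (Fintype.card F : WithBot ℕ) := by
  rw [frobSub_apply, degree_sub_eq_left_of_degree_lt]
  · simp
  · rw [degree_X_pow, degree_X]
    exact_mod_cast Fintype.one_lt_card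

open Polynomial in
lemma frobSub_pow_mul_X_pow_mem_of_lt {s d a n : ℕ} (h : Fintype.card F * a + n < d) :
    frobSub F F[X] X ^ a * X ^ n ∈ lowDegree F s d := by
  refine Submodule.mem_sup_left (mem_degreeLT.2 ?_)
  rw [degree_mul, degree_pow, degree_frobSub_X, degree_X_pow, nsmul_eq_mul]
  exact_mod_cast (by rw [mul_comm]; exact h)

-- With u = T^q - T, expand T^N = T^(N mod q) (T + u)^⌊N/q⌋. Terms with u-exponent at least s lie in
-- the ideal; the others have degree at most q(s - 1) + N mod q + ⌊N/q⌋ < qs - r.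
open Polynomial in
lemma frobSub_pow_mul_X_pow_mem {s r a N : ℕ} (hs : 1 ≤ s)
    (h : N % Fintype.card F + N / Fintype.card F < Fintype.card F - r) :
    frobSub F F[X] X ^ a * X ^ N ∈ lowDegree F s (Fintype.card F * s - r) := by
  set q := Fintype.card F with hq
  have h1 : (X : F[X]) ^ N = X ^ (N % q) * (frobSub F F[X] X + X) ^ (N / q) := by
    rw [frobSub_apply, sub_add_cancel, ← pow_mul, ← pow_add, Nat.mod_add_div]
  rw [h1, add_pow, Finset.mul_sum, Finset.mul_sum]
  refine Submodule.sum_mem _ fun i hi => ?_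
  have h2 : frobSub F F[X] X ^ a * (X ^ (N % q) * (frobSub F F[X] X ^ i * X ^ (N / q - i) *
      ((N / q).choose i : F[X]))) =
      (N / q).choose i • (frobSub F F[X] X ^ (a + i) * X ^ (N % q + (N / q - i))) := by
    rw [nsmul_eq_mul]; ring
  rw [h2]
  refine Submodule.smul_of_tower_mem _ _ ?_
  by_cases has : s ≤ a + i
  · refine Submodule.mem_sup_right ?_
    exact Ideal.mem_span_singleton.2 ((pow_dvd_pow _ has).mul_right _)
  · refine frobSub_pow_mul_X_pow_mem_of_lt ?_
    rw [← hq]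
    rw [Finset.mem_range] at hi
    obtain ⟨t, rfl⟩ : ∃ t, s = a + i + 1 + t := Nat.exists_eq_add_of_le (by omega)
    have : q * (a + i + 1 + t) = q * (a + i) + q + q * t := by ring
    omega

open MvPolynomial in
/-- The polynomials `∏ j, (X_j ^ q - X_j) ^ a_j * X_j ^ b_j`. -/
def basisPoly {m : ℕ} (F : Type*) [Field F] [Fintype F] (a b : Fin m → ℕ) :
    MvPolynomial (Fin m) F :=
  ∏ j, (frobSub F (MvPolynomial (Fin m) F) (X j) ^ a j * X j ^ b j)

-- The map x ↦ x^q - x is F-linear and kills the constant w_j.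
open Polynomial in
lemma lineHom_basisPoly {m : ℕ} (a b : Fin m → ℕ) (w v : Fin m → F) :
    lineHom w v (basisPoly F a b) =
      C (∏ j, v j ^ a j) * (frobSub F F[X] X ^ (∑ j, a j) * ∏ j, (C (w j) + C (v j) * X) ^ b j) := by
  have h : ∀ j, lineHom w v (frobSub F _ (MvPolynomial.X j)) = C (v j) * frobSub F F[X] X := by
    intro j
    rw [map_frobSub]
    simp only [lineHom, MvPolynomial.aeval_X]
    rw [map_add, ← algebraMap_eq, frobSub_algebraMap, zero_add, ← Algebra.smul_def, map_smul,
      Algebra.smul_def]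
  simp only [basisPoly, map_prod, map_mul, map_pow, h]
  simp only [lineHom, MvPolynomial.aeval_X, mul_pow, Finset.prod_mul_distrib,
    Finset.prod_pow_eq_pow_sum]
  ring

/-- All lines see `basisPoly F a b` as a polynomial of low degree, if `a` is small or `b` is not
bad. -/
theorem lineHom_basisPoly_mem [CharP F 2] {m s r : ℕ} (hm : 1 ≤ m) (hs : 1 ≤ s)
    (hr : r ≤ Fintype.card F) {a b : Fin m → ℕ} (hb : ∀ j, b j < Fintype.card F)
    (h : ∑ j, a j + m < s ∨ b ∉ badSet m (Fintype.card F) r) (w v : Fin m → F) :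
    lineHom w v (basisPoly F a b) ∈ lowDegree F s (Fintype.card F * s - r) := by
  set q := Fintype.card F with hq
  rw [lineHom_basisPoly, ← Polynomial.smul_eq_C_mul]
  refine Submodule.smul_mem _ _ ?_
  rw [prod_linear_pow, Finset.mul_sum]
  refine Submodule.sum_mem _ fun e he => ?_
  rw [mul_smul_comm]
  by_cases hodd : ∀ j, Odd ((b j).choose (e j))
  · refine Submodule.smul_mem _ _ ?_
    rw [mul_left_comm, ← Polynomial.smul_eq_C_mul]
    refine Submodule.smul_mem _ _ ?_
    rcases h with h | h
    -- Degree alone suffices: q|a| + m(q - 1) < q(s - 1) ≤ qs - r, by m ≥ 1 and r ≤ q.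
    · refine frobSub_pow_mul_X_pow_mem_of_lt ?_
      have h1 := sum_le_of_odd_choose Fintype.card_pos hb hodd
      rw [← hq] at h1 ⊢
      have hq1 : 0 < q := Fintype.card_pos
      obtain ⟨t, rfl⟩ : ∃ t, s = ∑ j, a j + m + 1 + t := Nat.exists_eq_add_of_le (by omega)
      have h2 : q * (∑ j, a j + m + 1 + t) = q * ∑ j, a j + m * q + q + q * t := by ring
      have h3 : m * (q - 1) + m = m * q := by
        obtain ⟨q', hq'⟩ := Nat.exists_eq_succ_of_ne_zero hq1.ne'
        rw [hq']; simp [Nat.mul_succ]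
      omega
    · refine frobSub_pow_mul_X_pow_mem hs ?_
      by_contra hcon
      exact h (mem_badSet.2 ⟨hb, e, hodd, not_lt.1 hcon⟩)
  · push Not at hodd
    obtain ⟨j, hj⟩ := hodd
    have : ((∏ j, (b j).choose (e j) : ℕ) : F) = 0 := by
      rw [CharP.cast_eq_zero_iff F 2]
      exact (even_iff_two_dvd.1 (Nat.not_odd_iff_even.1 hj)).trans
        (Finset.dvd_prod_of_mem _ (Finset.mem_univ j))
    rw [this, zero_smul]
    exact Submodule.zero_mem _

-- For w over F the translate of X_j^q - X_j is Y_j (Y_j^(q-1) - 1), which contributes the factor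
-- Y^a and a sign.
open MvPolynomial in
lemma coeff_translate_basisPoly {m : ℕ} (a : Fin m →₀ ℕ) (b : Fin m → ℕ) (w : Fin m → F)
    (i : Fin m →₀ ℕ) :
    (¬ a ≤ i → (translate w (basisPoly F a b)).coeff i = 0) ∧
      (translate w (basisPoly F a b)).coeff a = (-1) ^ a.degree * ∏ j, w j ^ b j := by
  have hq : Fintype.card F = 1 + (Fintype.card F - 1) := by
    have : 0 < Fintype.card F := Fintype.card_pos
    omega
  have h1 : ∀ j, translate w (frobSub F _ (X j)) =
      X j * (X j ^ (Fintype.card F - 1) - 1) := fun j => by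
    rw [map_frobSub]
    simp only [translate, aeval_X]
    rw [map_add, ← algebraMap_eq, frobSub_algebraMap, zero_add, frobSub_apply, hq,
      Nat.add_sub_cancel_left]
    ring
  have h2 : translate w (basisPoly F a b) = monomial a 1 *
      ∏ j, ((X j ^ (Fintype.card F - 1) - 1) ^ a j * (C (w j) + X j) ^ b j) := by
    simp only [basisPoly, map_prod, map_mul, map_pow, h1, mul_pow]
    simp only [translate, aeval_X, Finset.prod_mul_distrib]
    rw [monomial_eq, Finsupp.prod_fintype _ _ (fun _ => pow_zero _)]
    simp [mul_assoc]
  rw [h2]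
  constructor
  · intro h
    rw [coeff_monomial_mul', if_neg h]
  · rw [coeff_monomial_mul', if_pos le_rfl, tsub_self, one_mul, ← constantCoeff_eq]
    simp only [map_prod, map_mul, map_pow, map_sub, map_add, constantCoeff_X, constantCoeff_C,
      map_one, add_zero, Finset.prod_mul_distrib]
    rw [zero_pow (by have := Fintype.one_lt_card (α := F); omega), zero_sub,
      Finset.prod_pow_eq_pow_sum, Finsupp.degree_eq_sum]

open MvPolynomial in
lemma eq_zero_of_sum_monomials {m : ℕ} (c : (Fin m → Fin (Fintype.card F)) → F)
    (h : ∀ w : Fin m → F, ∑ b, c b * ∏ j, w j ^ (b j : ℕ) = 0) : c = 0 := by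
  classical
  have hp : (∑ b, monomial (Finsupp.equivFunOnFinite.symm fun j => (b j : ℕ)) (c b) :
      MvPolynomial (Fin m) F) = 0 := by
    refine eq_zero_of_eval_zero_at_prod_finset _ (fun _ => Finset.univ) (fun j => ?_)
      fun w _ => ?_
    · rw [Finset.card_univ, degreeOf_lt_iff Fintype.card_pos]
      intro d hd
      obtain ⟨b, -, hb⟩ := Finset.mem_biUnion.1 (support_sum hd)
      rw [Finset.mem_singleton.1 (support_monomial_subset hb)]
      exact (b j).isLt
    · rw [map_sum, ← h w]
      refine Finset.sum_congr rfl fun b _ => ?_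
      rw [eval_monomial, Finsupp.prod_fintype _ _ (fun _ => pow_zero _)]
      simp
  funext b
  have := congrArg (coeff (Finsupp.equivFunOnFinite.symm fun j => (b j : ℕ))) hp
  rw [coeff_sum, coeff_zero, Finset.sum_eq_single b] at this
  · simpa using this
  · intro b' _ hb'
    rw [coeff_monomial, if_neg]
    intro heq
    refine hb' (funext fun j => Fin.ext ?_)
    simpa using DFunLike.congr_fun heq j
  · simp

/-- Indices of the basis of the space of words. -/
abbrev BasisIndex (m s q : ℕ) : Type := {a : Fin m →₀ ℕ // a.degree < s} × (Fin m → Fin q)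

instance (m s : ℕ) : Finite {a : Fin m →₀ ℕ // a.degree < s} :=
  (Finsupp.finite_of_degree_lt s).to_subtype

instance (m s : ℕ) : Fintype {a : Fin m →₀ ℕ // a.degree < s} := Fintype.ofFinite _

/-- The linear combination of the basis polynomials with coefficients `c`. -/
def combination {m s : ℕ} (c : BasisIndex m s (Fintype.card F) → F) : MvPolynomial (Fin m) F :=
  ∑ p, c p • basisPoly F p.1.1 fun j => (p.2 j : ℕ)

/-- Induction on |a|: once the coefficients of smaller degree vanish, the Y^a-coefficient is ± ∑
c(a, b) w^b, a polynomial of degree below q in each variable that vanishes on F^m. -/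
theorem eq_zero_of_derivVec_combination {m s : ℕ} (c : BasisIndex m s (Fintype.card F) → F)
    (h : ∀ w, derivVec s (combination c) w = 0) : c = 0 := by
  have key : ∀ n : ℕ, ∀ a : {a : Fin m →₀ ℕ // a.degree < s}, a.1.degree = n →
      (fun b => c (a, b)) = 0 := by
    intro n
    induction n using Nat.strong_induction_on with
    | _ n ih =>
      rintro a rfl
      refine eq_zero_of_sum_monomials _ fun w => ?_
      have h1 := congrFun (h w) a
      rw [derivVec_apply, combination, map_sum, MvPolynomial.coeff_sum, Fintype.sum_prod_type,
        Finset.sum_eq_single a] at h1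
      · simp only [map_smul, MvPolynomial.coeff_smul,
          (coeff_translate_basisPoly a.1 _ w a.1).2, smul_eq_mul, Pi.zero_apply] at h1
        have h2 : (-1 : F) ^ a.1.degree * ∑ b, c (a, b) * ∏ j, w j ^ (b j : ℕ) = 0 := by
          rw [← h1, Finset.mul_sum]
          exact Finset.sum_congr rfl fun b _ => by ring
        exact (mul_eq_zero.1 h2).resolve_left (pow_ne_zero _ (by simp))
      · intro a' _ ha'
        refine Finset.sum_eq_zero fun b _ => ?_
        rw [map_smul, MvPolynomial.coeff_smul]
        by_cases hle : a'.1 ≤ a.1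
        · have hlt : a'.1.degree < a.1.degree := by
            obtain ⟨d, hd⟩ := exists_add_of_le hle
            have hd0 : d ≠ 0 := by
              rintro rfl
              exact ha' (Subtype.ext (by simpa using hd.symm))
            have : d.degree ≠ 0 := fun h0 => hd0 ((Finsupp.degree_eq_zero_iff d).1 h0)
            rw [hd, map_add]
            omega
          have := congrFun (ih _ hlt a' rfl) b
          simp only [Pi.zero_apply] at this
          rw [this, zero_smul]
        · rw [(coeff_translate_basisPoly a'.1 _ w a.1).1 hle, smul_zero]
      · simp
  funext p
  exact congrFun (key _ p.1 rfl) p.2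

theorem derivVec_combination_injective {m s : ℕ} :
    Function.Injective fun (c : BasisIndex m s (Fintype.card F) → F) (w : Fin m → F) =>
      derivVec s (combination c) w := by
  intro c c' h
  rw [← sub_eq_zero]
  refine eq_zero_of_derivVec_combination _ fun w => ?_
  have : combination (c - c') = combination c - combination c' := by
    simp [combination, sub_smul]
  rw [this, derivVec_sub, sub_eq_zero]
  exact congrFun h w

end FiniteField

/-! ### Counting basis indices and the rate -/

/-- The degree takes m values, and together with all coordinates but the first it determines a. -/
lemma card_degree_window (m s : ℕ) (hm : 1 ≤ m) :
    Fintype.card {a : {a : Fin m →₀ ℕ // a.degree < s} // s ≤ a.1.degree + m} ≤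
      m * s ^ (m - 1) := by
  obtain ⟨n, rfl⟩ := Nat.exists_eq_succ_of_ne_zero (Nat.one_le_iff_ne_zero.1 hm)
  have hinj : Function.Injective
      (fun a : {a : {a : Fin (n + 1) →₀ ℕ // a.degree < s} // s ≤ a.1.degree + (n + 1)} =>
        ((⟨a.1.1.degree + (n + 1) - s, by have := a.1.2; omega⟩ : Fin (n + 1)),
          fun j : Fin n => (⟨a.1.1 j.succ, (Finsupp.le_degree _ _).trans_lt a.1.2⟩ : Fin s))) := by
    intro a a' h
    rw [Prod.mk.injEq, Fin.mk.injEq] at h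
    have hs : ∀ j : Fin n, a.1.1 j.succ = a'.1.1 j.succ := fun j =>
      congrArg Fin.val (congrFun h.2 j)
    have hdeg : a.1.1.degree = a'.1.1.degree := by
      have := a.2
      have := a'.2
      omega
    refine Subtype.ext (Subtype.ext (Finsupp.ext fun j => ?_))
    refine Fin.cases ?_ hs j
    rw [Finsupp.degree_eq_sum, Finsupp.degree_eq_sum, Fin.sum_univ_succ, Fin.sum_univ_succ,
      Finset.sum_congr rfl fun j _ => hs j] at hdeg
    exact Nat.add_right_cancel hdeg
  simpa using Fintype.card_le_of_injective _ hinj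

/-- A cube of side ⌊(s - 1)/m⌋ + 1 ≥ s/m fits inside the simplex. -/
lemma pow_le_card_exponents (m s : ℕ) (hs : 1 ≤ s) :
    s ^ m ≤ m ^ m * Fintype.card {a : Fin m →₀ ℕ // a.degree < s} := by
  obtain rfl | hm := Nat.eq_zero_or_pos m
  · have : Nonempty {a : Fin 0 →₀ ℕ // a.degree < s} :=
      ⟨⟨0, by simpa using Nat.lt_of_lt_of_le one_pos hs⟩⟩
    rw [pow_zero, pow_zero, one_mul]
    exact Fintype.card_pos
  set t := (s - 1) / m + 1 with ht
  have hst : s ≤ m * t := by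
    have := Nat.lt_mul_div_succ (s - 1) hm
    rw [← ht] at this
    omega
  have hlt : ∀ f : Fin m → Fin t,
      (Finsupp.equivFunOnFinite.symm fun j => (f j : ℕ)).degree < s := fun f => by
    rw [Finsupp.degree_eq_sum]
    calc _ ≤ ∑ _j : Fin m, (s - 1) / m := Finset.sum_le_sum fun j _ => by
          have := (f j).isLt
          simp only [Finsupp.equivFunOnFinite_symm_apply_apply]
          omega
      _ = m * ((s - 1) / m) := by simp
      _ ≤ s - 1 := Nat.mul_div_le _ _
      _ < s := by omega
  have hinj : Function.Injective (fun f : Fin m → Fin t =>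
      (⟨Finsupp.equivFunOnFinite.symm fun j => (f j : ℕ), hlt f⟩ :
        {a : Fin m →₀ ℕ // a.degree < s})) := by
    intro f f' h
    funext j
    exact Fin.ext (by simpa using DFunLike.congr_fun (congrArg Subtype.val h) j)
  have hcard := Fintype.card_le_of_injective _ hinj
  rw [Fintype.card_fun, Fintype.card_fin, Fintype.card_fin] at hcard
  calc s ^ m ≤ (m * t) ^ m := Nat.pow_le_pow_left hst m
    _ = m ^ m * t ^ m := mul_pow _ _ _
    _ ≤ _ := Nat.mul_le_mul_left _ hcard

/-- Indices of basis polynomials which may fail to lie in the code. -/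
abbrev IsBadIndex {m s q : ℕ} (r : ℕ) (p : BasisIndex m s q) : Prop :=
  s ≤ p.1.1.degree + m ∧ (fun j => (p.2 j : ℕ)) ∈ badSet m q r

open Classical in
lemma card_isBadIndex_le (m s q r : ℕ) (hm : 1 ≤ m) :
    Fintype.card {p : BasisIndex m s q // IsBadIndex r p} ≤
      m * s ^ (m - 1) * (badSet m q r).card := by
  have hinj : Function.Injective (fun p : {p : BasisIndex m s q // IsBadIndex r p} =>
      ((⟨p.1.1, p.2.1⟩ : {a : {a : Fin m →₀ ℕ // a.degree < s} // s ≤ a.1.degree + m}),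
        (⟨_, p.2.2⟩ : {b // b ∈ badSet m q r}))) := by
    intro p p' h
    obtain ⟨h1, h2⟩ := Prod.mk.inj h
    exact Subtype.ext (Prod.ext (congrArg Subtype.val h1)
      (funext fun j => Fin.ext (congrFun (congrArg Subtype.val h2) j)))
  have := Fintype.card_le_of_injective _ hinj
  rw [Fintype.card_prod, Fintype.card_coe] at this
  exact this.trans (Nat.mul_le_mul_right _ (card_degree_window m s hm))

open Classical in
/-- Extension by zero of coefficients on the good indices. -/
def extendGood {m s q r : ℕ} {F : Type*} [Field F]
    (c : {p : BasisIndex m s q // ¬ IsBadIndex r p} → F) :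
    BasisIndex m s q → F :=
  fun p => if h : ¬ IsBadIndex r p then c ⟨p, h⟩ else 0

lemma extendGood_injective {m s q r : ℕ} {F : Type*} [Field F] :
    Function.Injective (extendGood (F := F) (m := m) (s := s) (q := q) (r := r)) := by
  intro c c' h
  funext p
  have := congrFun h p.1
  simpa only [extendGood, dif_pos p.2] using this

variable {F : Type*} [Field F] [Fintype F]

lemma derivVec_mem_code [CharP F 2] {m s r : ℕ} (hm : 1 ≤ m) (hs : 1 ≤ s)
    (hr : r ≤ Fintype.card F)
    (c : {p : BasisIndex m s (Fintype.card F) // ¬ IsBadIndex r p} → F) :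
    (fun w => derivVec s (combination (extendGood c)) w) ∈
      liftedMultiplicityCode m s (Fintype.card F * s - r) F := by
  refine ⟨_, fun w v => exists_equivUpTo_of_mem_lowDegree ?_, rfl⟩
  rw [← lineHom_apply, combination, map_sum]
  refine Submodule.sum_mem _ fun p _ => ?_
  rw [map_smul]
  by_cases hp : IsBadIndex r p
  · rw [extendGood, dif_neg (not_not.2 hp), zero_smul]
    exact Submodule.zero_mem _
  · refine Submodule.smul_mem _ _ (lineHom_basisPoly_mem hm hs hr (fun j => (p.2 j).isLt) ?_ w v)
    rw [← Finsupp.degree_eq_sum]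
    by_cases h : p.1.1.degree + m < s
    · exact Or.inl h
    · exact Or.inr fun hb => hp ⟨not_lt.1 h, hb⟩

open Classical in
lemma card_code_bounds [CharP F 2] {m s r : ℕ} (hm : 1 ≤ m) (hs : 1 ≤ s)
    (hr : r ≤ Fintype.card F) :
    Fintype.card F ^ Fintype.card {p : BasisIndex m s (Fintype.card F) // ¬ IsBadIndex r p} ≤
        Nat.card (liftedMultiplicityCode m s (Fintype.card F * s - r) F) ∧
      Nat.card (liftedMultiplicityCode m s (Fintype.card F * s - r) F) ≤
        Fintype.card F ^ Fintype.card (BasisIndex m s (Fintype.card F)) := by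
  constructor
  · have hinj : Function.Injective
        (fun c : {p : BasisIndex m s (Fintype.card F) // ¬ IsBadIndex r p} → F =>
          (⟨_, derivVec_mem_code hm hs hr c⟩ :
            liftedMultiplicityCode m s (Fintype.card F * s - r) F)) := fun c c' h =>
      extendGood_injective (derivVec_combination_injective (Subtype.mk.inj h))
    have := Nat.card_le_card_of_injective _ hinj
    rwa [Nat.card_eq_fintype_card, Fintype.card_fun] at this
  · have := Nat.card_le_card_of_injective
      (Subtype.val : liftedMultiplicityCode m s (Fintype.card F * s - r) F → _)
      Subtype.val_injective
    rw [Nat.card_eq_fintype_card (α := (Fin m → F) → Alphabet m s F), Fintype.card_fun,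
      Fintype.card_fun, ← pow_mul, Fintype.card_fun, Fintype.card_fin] at this
    rwa [Fintype.card_prod, Fintype.card_fun, Fintype.card_fin, Fintype.card_fin]

open Classical in
theorem abs_one_sub_codeRate_le [CharP F 2] {m s r : ℕ} (hm : 1 ≤ m) (hs : 1 ≤ s)
    (hr : r ≤ Fintype.card F) :
    |1 - codeRate (liftedMultiplicityCode m s (Fintype.card F * s - r) F)| ≤
      (Fintype.card {p : BasisIndex m s (Fintype.card F) // IsBadIndex r p} : ℝ) /
        Fintype.card (BasisIndex m s (Fintype.card F)) := by
  obtain ⟨hlow, hup⟩ := card_code_bounds (F := F) hm hs hr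
  set M := Nat.card (liftedMultiplicityCode m s (Fintype.card F * s - r) F)
  rw [Fintype.card_subtype_compl] at hlow
  have hle := Fintype.card_subtype_le (IsBadIndex (m := m) (s := s) (q := Fintype.card F) r)
  set B := Fintype.card {p : BasisIndex m s (Fintype.card F) // IsBadIndex r p}
  set T := Fintype.card (BasisIndex m s (Fintype.card F)) with hT
  have hD : 0 < Fintype.card {a : Fin m →₀ ℕ // a.degree < s} :=
    Fintype.card_pos_iff.2 ⟨⟨0, by simpa using Nat.lt_of_lt_of_le one_pos hs⟩⟩
  have hq : 1 < Fintype.card F := Fintype.one_lt_card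
  have hTD : T = Fintype.card {a : Fin m →₀ ℕ // a.degree < s} * Fintype.card F ^ m := by
    rw [hT, Fintype.card_prod, Fintype.card_fun, Fintype.card_fin, Fintype.card_fin]
  have hT0 : 0 < T := by rw [hTD]; positivity
  set D := Fintype.card {a : Fin m →₀ ℕ // a.degree < s}
  set q := Fintype.card F
  have hlogq : 0 < Real.log q := Real.log_pos (by exact_mod_cast hq)
  have hM0 : 0 < M := lt_of_lt_of_le (by positivity) hlow
  have hrate : codeRate (liftedMultiplicityCode m s (q * s - r) F) =
      Real.log M / (T * Real.log q) := by
    rw [codeRate, Nat.card_eq_fintype_card (α := Alphabet m s F),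
      Nat.card_eq_fintype_card (α := Fin m → F), Fintype.card_fun, Fintype.card_fun,
      Fintype.card_fin, Real.logb, div_div, Nat.cast_pow, Real.log_pow, hTD]
    push_cast
    ring
  have h1 : ((T : ℝ) - B) * Real.log q ≤ Real.log M := by
    have := Real.log_le_log (by positivity)
      (Nat.cast_le.2 hlow : ((q ^ (T - B) : ℕ) : ℝ) ≤ (M : ℝ))
    rwa [Nat.cast_pow, Real.log_pow, Nat.cast_sub hle] at this
  have h2 : Real.log M ≤ T * Real.log q := by
    have := Real.log_le_log (by positivity) (Nat.cast_le.2 hup : (M : ℝ) ≤ ((q ^ T : ℕ) : ℝ))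
    rwa [Nat.cast_pow, Real.log_pow] at this
  have hT' : (0 : ℝ) < T := by exact_mod_cast hT0
  have h3 : 1 - Real.log M / (T * Real.log q) =
      (T * Real.log q - Real.log M) / (T * Real.log q) := by
    rw [sub_div, div_self (by positivity)]
  rw [hrate, h3, abs_of_nonneg (div_nonneg (by linarith) (by positivity)),
    div_le_div_iff₀ (by positivity) hT']
  have : (T * Real.log q - Real.log M) * T ≤ (B * Real.log q) * T :=
    mul_le_mul_of_nonneg_right (by linarith) hT'.le
  linarith

/-- The window costs m s^(m-1) and the simplex bound m^m, whence the factor m^(m+1)/s. -/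
theorem abs_one_sub_codeRate_le_badSet [CharP F 2] {m s r : ℕ} (hm : 1 ≤ m) (hs : 1 ≤ s)
    (hr : r ≤ Fintype.card F) :
    |1 - codeRate (liftedMultiplicityCode m s (Fintype.card F * s - r) F)| ≤
      m ^ (m + 1) * ((s : ℝ)⁻¹ *
        ((badSet m (Fintype.card F) r).card / (Fintype.card F : ℝ) ^ m)) := by
  classical
  refine (abs_one_sub_codeRate_le hm hs hr).trans ?_
  have h1 := card_isBadIndex_le m s (Fintype.card F) r hm
  have h2 := pow_le_card_exponents m s hs
  rw [Fintype.card_prod, Fintype.card_fun, Fintype.card_fin, Fintype.card_fin]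
  have hq : 0 < Fintype.card F := Fintype.card_pos
  have hD : 0 < Fintype.card {a : Fin m →₀ ℕ // a.degree < s} :=
    Fintype.card_pos_iff.2 ⟨⟨0, by simpa using Nat.lt_of_lt_of_le one_pos hs⟩⟩
  set D := Fintype.card {a : Fin m →₀ ℕ // a.degree < s}
  set B := Fintype.card {p : BasisIndex m s (Fintype.card F) // IsBadIndex r p}
  set q := Fintype.card F
  set b := (badSet m q r).card
  have h1' : (B : ℝ) ≤ m * s ^ (m - 1) * b := by exact_mod_cast h1
  have h2' : (s : ℝ) ^ m ≤ m ^ m * D := by exact_mod_cast h2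
  have hsm : (s : ℝ) ^ m = s * s ^ (m - 1) := by
    rw [← pow_succ', Nat.sub_add_cancel hm]
  have hs0 : (0 : ℝ) < s := by exact_mod_cast hs
  have hD0 : (0 : ℝ) < D := by exact_mod_cast hD
  have hq0 : (0 : ℝ) < q := by exact_mod_cast hq
  have h3 : (m : ℝ) ^ (m + 1) * ((s : ℝ)⁻¹ * (b / (q : ℝ) ^ m)) =
      (m ^ (m + 1) * b) / (s * q ^ m) := by
    rw [div_eq_mul_inv, div_eq_mul_inv, mul_inv]; ring
  rw [h3, div_le_div_iff₀ (by positivity) (by positivity)]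
  push_cast
  calc (B : ℝ) * (s * q ^ m) ≤ (m * s ^ (m - 1) * b) * (s * q ^ m) := by gcongr
    _ = s ^ m * (m * b * q ^ m) := by rw [hsm]; ring
    _ ≤ (m ^ m * D) * (m * b * q ^ m) := by gcongr
    _ = _ := by ring

/-! ### Vanishing on lines and the distance -/

section Distance

variable {m : ℕ} {F : Type*} [Field F]

lemma lineHom_zero_coeff (v : Fin m → F) (p : MvPolynomial (Fin m) F) (k : ℕ) :
    (lineHom 0 v p).coeff k = MvPolynomial.eval v (MvPolynomial.homogeneousComponent k p) := by
  induction p using MvPolynomial.induction_on' with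
  | add p q hp hq => rw [map_add, Polynomial.coeff_add, hp, hq, map_add, map_add]
  | monomial d c =>
    have h1 : lineHom 0 v (MvPolynomial.monomial d c) =
        Polynomial.C (c * ∏ j, v j ^ d j) * Polynomial.X ^ d.degree := by
      rw [lineHom, MvPolynomial.aeval_monomial, Finsupp.prod_fintype _ _ (fun _ => pow_zero _)]
      simp only [Pi.zero_apply, map_zero, zero_add, mul_pow, Finset.prod_mul_distrib,
        Finset.prod_pow_eq_pow_sum, Polynomial.algebraMap_eq, map_mul, map_prod, map_pow,
        Finsupp.degree_eq_sum]
      ring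
    rw [h1, Polynomial.coeff_C_mul_X_pow,
      MvPolynomial.homogeneousComponent_of_mem (MvPolynomial.isHomogeneous_monomial c rfl)]
    split_ifs
    · rw [MvPolynomial.eval_monomial, Finsupp.prod_fintype _ _ (fun _ => pow_zero _)]
    · rw [map_zero]

lemma lineHom_zero_translate (w v : Fin m → F) (f : MvPolynomial (Fin m) F) :
    lineHom 0 v (translate w f) = lineHom w v f := by
  have h : (lineHom 0 v).comp (translate w) = lineHom w v :=
    MvPolynomial.algHom_ext fun j => by simp [lineHom, translate]
  rw [← h, AlgHom.comp_apply]

lemma taylor_lineHom (w v : Fin m → F) (x : F) (f : MvPolynomial (Fin m) F) :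
    Polynomial.taylor x (lineHom w v f) = lineHom (w + x • v) v f := by
  refine DFunLike.congr_fun (f := (Polynomial.taylorAlgHom x).comp (lineHom w v))
    (g := lineHom (w + x • v) v) (MvPolynomial.algHom_ext fun j => ?_) f
  rw [AlgHom.comp_apply]
  change Polynomial.taylor x (lineHom w v (MvPolynomial.X j)) = _
  simp only [lineHom, MvPolynomial.aeval_X, map_add, Polynomial.taylor_mul, Polynomial.taylor_C,
    Polynomial.taylor_X, Pi.add_apply, Pi.smul_apply, smul_eq_mul, Polynomial.C_mul]
  ring

/-- Recentring the line at w + x v shows that a point where all derivatives of order below s vanish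
is a zero of multiplicity s on every line through it. -/
lemma eval_hasseDeriv_lineRestrict (w v : Fin m → F) (x : F) (f : MvPolynomial (Fin m) F) (k : ℕ) :
    (Polynomial.hasseDeriv k (lineRestrict f w v)).eval x = MvPolynomial.eval v
      (MvPolynomial.homogeneousComponent k (translate (w + x • v) f)) := by
  rw [← Polynomial.taylor_coeff, ← lineHom_apply, taylor_lineHom, ← lineHom_zero_translate,
    lineHom_zero_coeff]

lemma homogeneousComponent_translate_eq_zero {s k : ℕ} (hk : k < s) {f : MvPolynomial (Fin m) F}
    {w : Fin m → F} (h : derivVec s f w = 0) :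
    MvPolynomial.homogeneousComponent k (translate w f) = 0 := by
  ext i
  rw [MvPolynomial.coeff_homogeneousComponent, MvPolynomial.coeff_zero]
  split_ifs with hi
  · rw [← derivVec_apply s f w ⟨i, hi ▸ hk⟩, h, Pi.zero_apply]
  · rfl

open Polynomial in
lemma X_sub_C_pow_dvd {g : F[X]} {x : F} {s : ℕ} (h : ∀ k < s, (hasseDeriv k g).eval x = 0) :
    (X - C x) ^ s ∣ g := by
  have h1 : X ^ s ∣ taylor x g := X_pow_dvd_iff.2 fun k hk => by rw [taylor_coeff, h k hk]
  have h2 := map_dvd (taylorAlgHom (-x)) h1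
  rw [map_pow] at h2
  change taylor (-x) X ^ s ∣ taylor (-x) (taylor x g) at h2
  rwa [taylor_taylor, neg_add_cancel, taylor_zero, taylor_X, C_neg, ← sub_eq_add_neg] at h2

open Polynomial in
lemma card_mul_lt_of_hasseDeriv_eq_zero {g : F[X]} (hg : g ≠ 0) {s d : ℕ}
    (hd : g.degree < (d : WithBot ℕ)) (Z : Finset F)
    (hZ : ∀ x ∈ Z, ∀ k < s, (hasseDeriv k g).eval x = 0) : Z.card * s < d := by
  have h1 : ∏ x ∈ Z, (X - C x) ^ s ∣ g := by
    refine Finset.prod_dvd_of_coprime (fun x _ y _ hxy => ?_) fun x hx => X_sub_C_pow_dvd (hZ x hx)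
    exact (pairwise_coprime_X_sub_C Function.injective_id hxy).pow
  have h2 := natDegree_le_of_dvd h1 hg
  rw [natDegree_prod_of_monic _ _ fun x _ => (monic_X_sub_C x).pow s] at h2
  simp only [natDegree_pow, natDegree_X_sub_C, mul_one, Finset.sum_const, smul_eq_mul] at h2
  exact h2.trans_lt ((natDegree_lt_iff_degree_lt hg).2 hd)

variable [Fintype F]

-- The t-th Hasse derivative at 0 shows g ≠ 0. If Z parameters give zeros of multiplicity s, then Z
-- s < qs - r, so more than r/s parameters survive; discarding x = 0 costs at most one.
open Classical in
lemma div_le_card_line {s r : ℕ} (hs : 1 ≤ s)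
    {f : MvPolynomial (Fin m) F} {w v : Fin m → F} {g : Polynomial F}
    (hg : g.degree < ((Fintype.card F * s - r : ℕ) : WithBot ℕ))
    (hfg : EquivUpTo s (lineRestrict f w v) g) {t : ℕ} (ht : t < s)
    (hv : MvPolynomial.eval v (MvPolynomial.homogeneousComponent t (translate w f)) ≠ 0) :
    r / s ≤ (Finset.univ.filter fun x : F => x ≠ 0 ∧ derivVec s f (w + x • v) ≠ 0).card := by
  have hg0 : g ≠ 0 := by
    rintro rfl
    have := hfg t ht 0
    rw [eval_hasseDeriv_lineRestrict, zero_smul, add_zero] at this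
    simp [hv] at this
  have hZ := card_mul_lt_of_hasseDeriv_eq_zero hg0 hg
    (Finset.univ.filter fun x : F => derivVec s f (w + x • v) = 0) (s := s) fun x hx k hk => by
      rw [← hfg k hk, eval_hasseDeriv_lineRestrict,
        homogeneousComponent_translate_eq_zero hk (Finset.mem_filter.1 hx).2, map_zero]
  have hcompl := Finset.card_filter_add_card_filter_not (s := (Finset.univ : Finset F))
    (fun x : F => derivVec s f (w + x • v) = 0)
  rw [Finset.card_univ] at hcompl
  have herase : (Finset.univ.filter fun x : F => ¬ derivVec s f (w + x • v) = 0).card ≤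
      (Finset.univ.filter fun x : F => x ≠ 0 ∧ derivVec s f (w + x • v) ≠ 0).card + 1 := by
    refine (Finset.card_le_card (t := insert 0 (Finset.univ.filter fun x : F => x ≠ 0 ∧
      derivVec s f (w + x • v) ≠ 0)) fun x hx => ?_).trans (Finset.card_insert_le _ _)
    by_cases hx0 : x = 0
    · simp [hx0]
    · simp [hx0, (Finset.mem_filter.1 hx).2]
  set Z := (Finset.univ.filter fun x : F => derivVec s f (w + x • v) = 0).card
  set N := (Finset.univ.filter fun x : F => ¬ derivVec s f (w + x • v) = 0).card
  have h1 : r < N * s := by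
    rw [← hcompl, add_mul] at hZ
    omega
  have := (Nat.div_lt_iff_lt_mul hs).2 h1
  omega

open Classical in
lemma card_eval_eq_zero_mul_le {h : MvPolynomial (Fin m) F} (h0 : h ≠ 0) {t : ℕ}
    (ht : h.totalDegree ≤ t) :
    (Finset.univ.filter fun v : Fin m → F => MvPolynomial.eval v h = 0).card * Fintype.card F ≤
      t * Fintype.card F ^ m := by
  have hq : (0 : ℚ≥0) < Fintype.card F := by exact_mod_cast Fintype.card_pos
  have := MvPolynomial.schwartz_zippel_totalDegree h0 (Finset.univ : Finset F)
  rw [Fintype.piFinset_univ, Finset.card_univ, div_le_div_iff₀ (by positivity) hq] at this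
  have h1 : (Finset.univ.filter fun v : Fin m → F => MvPolynomial.eval v h = 0).card *
      Fintype.card F ≤ h.totalDegree * Fintype.card F ^ m := by exact_mod_cast this
  exact h1.trans (Nat.mul_le_mul_right _ ht)

-- Pairs (v, x) are counted twice. Schwartz–Zippel leaves enough directions v, each with at least
-- ⌊r/s⌋ parameters x; conversely v ↦ w + x v is injective for x ≠ 0, so each support point arises
-- at most q times.
open Classical in
theorem card_derivVec_ne_zero {s r : ℕ} {f : MvPolynomial (Fin m) F}
    (hf : ∀ w v : Fin m → F, ∃ g : Polynomial F,
      g.degree < ((Fintype.card F * s - r : ℕ) : WithBot ℕ) ∧ EquivUpTo s (lineRestrict f w v) g)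
    {w : Fin m → F} (hw : derivVec s f w ≠ 0) :
    r / s * ((Fintype.card F - s) * Fintype.card F ^ m) ≤
      (Finset.univ.filter fun w => derivVec s f w ≠ 0).card * Fintype.card F ^ 2 := by
  obtain ⟨⟨i, hi⟩, hne⟩ := Function.ne_iff.1 hw
  rw [derivVec_apply, Pi.zero_apply] at hne
  set h := MvPolynomial.homogeneousComponent i.degree (translate w f) with hh
  have h0 : h ≠ 0 := by
    intro hz
    have := MvPolynomial.coeff_homogeneousComponent i.degree (translate w f) i
    rw [← hh, hz, if_pos rfl, MvPolynomial.coeff_zero] at this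
    exact hne this.symm
  have hSZ := card_eval_eq_zero_mul_le h0
    (MvPolynomial.homogeneousComponent_isHomogeneous i.degree (translate w f)).totalDegree_le
  have hcompl := Finset.card_filter_add_card_filter_not (s := (Finset.univ : Finset (Fin m → F)))
    (fun v => MvPolynomial.eval v h = 0)
  rw [Finset.card_univ, Fintype.card_fun, Fintype.card_fin] at hcompl
  set q := Fintype.card F with hq
  set V := Finset.univ.filter fun v : Fin m → F => ¬ MvPolynomial.eval v h = 0 with hV
  have hlow : r / s * V.card ≤
      (V.sigma fun v => Finset.univ.filter fun x : F =>
        x ≠ 0 ∧ derivVec s f (w + x • v) ≠ 0).card := by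
    rw [Finset.card_sigma, mul_comm, ← smul_eq_mul]
    refine Finset.card_nsmul_le_sum _ _ _ fun v hv => ?_
    obtain ⟨g, hg, hfg⟩ := hf w v
    exact div_le_card_line (by omega) hg hfg hi (Finset.mem_filter.1 hv).2
  have hup : (V.sigma fun v => Finset.univ.filter fun x : F =>
      x ≠ 0 ∧ derivVec s f (w + x • v) ≠ 0).card ≤
      (Finset.univ.filter fun w => derivVec s f w ≠ 0).card * q := by
    rw [hq, ← Finset.card_univ, ← Finset.card_product]
    refine Finset.card_le_card_of_injOn (fun p => (w + p.2 • p.1, p.2)) (fun p hp => ?_) ?_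
    · have := (Finset.mem_filter.1 (Finset.mem_sigma.1 hp).2).2.2
      simpa using this
    · rintro ⟨v, x⟩ hp ⟨v', x'⟩ _ heq
      obtain ⟨h1, rfl⟩ := Prod.mk.inj heq
      have hx : x ≠ 0 := (Finset.mem_filter.1 (Finset.mem_sigma.1 hp).2).2.1
      have : v = v' := smul_right_injective _ hx (add_left_cancel h1)
      rw [this]
  have hVq : (q - s) * q ^ m ≤ V.card * q := by
    have h1 : i.degree * q ^ m ≤ s * q ^ m := Nat.mul_le_mul_right _ hi.le
    have h2 := congrArg (· * q) hcompl
    simp only [add_mul] at h2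
    rw [Nat.sub_mul, mul_comm q (q ^ m)]
    omega
  calc r / s * ((q - s) * q ^ m) ≤ r / s * (V.card * q) := Nat.mul_le_mul_left _ hVq
    _ = (r / s * V.card) * q := by ring
    _ ≤ ((Finset.univ.filter fun w => derivVec s f w ≠ 0).card * q) * q :=
        Nat.mul_le_mul_right _ (hlow.trans hup)
    _ = _ := by ring

end Distance

/-! ### The value and asymptotics of Δ_min -/

/-- The argument is ⌊r/s⌋ minus (s - 1 - r mod s)/s, and that fraction lies in [0, 1). -/
lemma ceil_eq_div (s r : ℕ) (hs : 1 ≤ s) :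
    ⌈((r : ℝ) - (s : ℝ) + 1) / (s : ℝ)⌉ = ((r / s : ℕ) : ℤ) := by
  have hs0 : (0 : ℝ) < s := by exact_mod_cast hs
  have h1 : (r : ℝ) = s * (r / s : ℕ) + (r % s : ℕ) := by exact_mod_cast (Nat.div_add_mod r s).symm
  have h2 : ((r % s : ℕ) : ℝ) + 1 ≤ s := by exact_mod_cast Nat.mod_lt r hs
  have h3 : (0 : ℝ) ≤ (r % s : ℕ) := Nat.cast_nonneg _
  rw [Int.ceil_eq_iff, lt_div_iff₀ hs0, div_le_iff₀ hs0, Int.cast_natCast]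
  constructor <;> nlinarith

lemma deltaMin_eq (s q r : ℕ) (hs : 1 ≤ s) :
    deltaMin s q r = (r / s : ℕ) * (((q : ℝ) - s) / (q : ℝ) ^ 2) := by
  rw [deltaMin, ceil_eq_div s r hs, Int.cast_natCast]

theorem deltaMin_le_relativeDistance {m s r : ℕ} {F : Type*} [Field F] [Fintype F] (hs : 1 ≤ s)
    (hsq : s ≤ Fintype.card F) :
    ((deltaMin s (Fintype.card F) r : ℝ) : EReal) ≤
      relativeDistance (liftedMultiplicityCode m s (Fintype.card F * s - r) F) := by
  classical
  rw [relativeDistance]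
  refine le_iInf₂ fun c hc => le_iInf₂ fun c' hc' => le_iInf fun hne => EReal.coe_le_coe_iff.2 ?_
  obtain ⟨f, hf, rfl⟩ := hc
  obtain ⟨f', hf', rfl⟩ := hc'
  obtain ⟨w, hw⟩ := Function.ne_iff.1 hne
  have hline : ∀ w v : Fin m → F, ∃ g : Polynomial F,
      g.degree < ((Fintype.card F * s - r : ℕ) : WithBot ℕ) ∧
        EquivUpTo s (lineRestrict (f - f') w v) g := fun w v => by
    obtain ⟨g, hg, hfg⟩ := hf w v
    obtain ⟨g', hg', hfg'⟩ := hf' w v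
    refine ⟨g - g', (Polynomial.degree_sub_le _ _).trans_lt (max_lt hg hg'), fun k hk x => ?_⟩
    rw [← lineHom_apply, map_sub, lineHom_apply, lineHom_apply, map_sub, map_sub,
      Polynomial.eval_sub, Polynomial.eval_sub, hfg k hk, hfg' k hk]
  have key := card_derivVec_ne_zero hline (w := w) (by rw [derivVec_sub]; exact sub_ne_zero.2 hw)
  let _ : DecidableEq (Alphabet m s F) := fun a b => Classical.propDecidable (a = b)
  have hdist : (Finset.univ.filter fun w => derivVec s (f - f') w ≠ 0).card =
      hammingDist (fun w => derivVec s f w) (fun w => derivVec s f' w) := by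
    rw [hammingDist]
    refine congrArg Finset.card (Finset.filter_congr fun w _ => ?_)
    rw [derivVec_sub, sub_ne_zero]
  replace key : r / s * ((Fintype.card F - s) * Fintype.card F ^ m) ≤
      hammingDist (fun w => derivVec s f w) (fun w => derivVec s f' w) * Fintype.card F ^ 2 := by
    rw [← hdist]
    convert key
  have hq : (0 : ℝ) < Fintype.card F := by exact_mod_cast Fintype.card_pos
  rw [deltaMin_eq _ _ _ hs, Fintype.card_fun, Fintype.card_fin, mul_div_assoc',
    div_le_div_iff₀ (by positivity) (by positivity)]
  rw [← Nat.cast_sub hsq, mul_assoc]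
  exact_mod_cast key

/-- The quotient is exactly (1 - (r mod s)/r)(1 - s/q), and the second factor tends to 1. -/
theorem deltaMin_isEquivalent_iff (s q r : ℕ → ℕ) (hs : ∀ n, 1 ≤ s n) (hq : ∀ n, 1 ≤ q n)
    (hr : ∀ n, 1 ≤ r n)
    (hsq : (fun n => (s n : ℝ)) =o[atTop] (fun n => (q n : ℝ))) :
    ((fun n => deltaMin (s n) (q n) (r n)) ~[atTop]
        (fun n => (r n : ℝ) / ((q n : ℝ) * (s n : ℝ))) ↔
      (fun n => ((r n % s n : ℕ) : ℝ)) =o[atTop] (fun n => (r n : ℝ))) := by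
  have hs0 : ∀ n, (0 : ℝ) < s n := fun n => by exact_mod_cast hs n
  have hq0 : ∀ n, (0 : ℝ) < q n := fun n => by exact_mod_cast hq n
  have hr0 : ∀ n, (0 : ℝ) < r n := fun n => by exact_mod_cast hr n
  rw [isEquivalent_iff_tendsto_one (Eventually.of_forall fun n =>
      (div_pos (hr0 n) (mul_pos (hq0 n) (hs0 n))).ne'),
    isLittleO_iff_tendsto fun n h => absurd h (hr0 n).ne']
  rw [isLittleO_iff_tendsto fun n h => absurd h (hq0 n).ne'] at hsq
  have hσ : Tendsto (fun n => 1 - (s n : ℝ) / q n) atTop (nhds 1) := by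
    simpa using tendsto_const_nhds.sub hsq
  have heq : ((fun n => deltaMin (s n) (q n) (r n)) /
      fun n => (r n : ℝ) / ((q n : ℝ) * (s n : ℝ))) =
      fun n => (1 - ((r n % s n : ℕ) : ℝ) / r n) * (1 - (s n : ℝ) / q n) := by
    funext n
    have h1 : ((r n % s n : ℕ) : ℝ) = r n - s n * (r n / s n : ℕ) := by
      rw [eq_sub_iff_add_eq']
      exact_mod_cast Nat.div_add_mod (r n) (s n)
    have := (hs0 n).ne'
    have := (hq0 n).ne'
    have := (hr0 n).ne'
    rw [Pi.div_apply, deltaMin_eq _ _ _ (hs n), h1]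
    field_simp
    ring
  rw [heq]
  constructor
  · intro h
    have h2 := h.div hσ one_ne_zero
    have h3 : Tendsto (fun n => 1 - ((r n % s n : ℕ) : ℝ) / r n) atTop (nhds (1 / 1)) := by
      refine h2.congr' ?_
      filter_upwards [hσ.eventually_ne one_ne_zero] with n hn
      exact mul_div_cancel_right₀ _ hn
    simpa using (tendsto_const_nhds (x := (1 : ℝ))).sub h3
  · intro h
    simpa using ((tendsto_const_nhds (x := (1 : ℝ))).sub h).mul hσ

/-! ### From digit counts to the exponent log₂ λ_m - m -/

/-- Comparison of `(μ / 2 ^ m) ^ k` with the real power `x ^ (log₂ μ - m)` for `x` near `2 ^ k`. -/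
lemma pow_div_le_rpow {μ ν x : ℝ} (hμ : 0 < μ) (hμν : μ ≤ ν) (m k M : ℕ)
    (hx1 : (2 : ℝ) ^ k ≤ x) (hx2 : x ≤ 2 ^ M * 2 ^ k) :
    (μ / 2 ^ m) ^ k ≤ ((2 : ℝ) ^ M) ^ |Real.logb 2 μ - m| * x ^ (Real.logb 2 ν - m) := by
  set α := Real.logb 2 μ - m with hα
  have h2k : (1 : ℝ) ≤ 2 ^ k := one_le_pow₀ one_le_two
  have h2k0 : (0 : ℝ) < 2 ^ k := by positivity
  have hx : 1 ≤ x := h2k.trans hx1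
  have h1 : (μ / 2 ^ m) ^ k = ((2 : ℝ) ^ k) ^ α := by
    have : (2 : ℝ) ^ α = μ / 2 ^ m := by
      rw [hα, Real.rpow_sub two_pos, Real.rpow_logb two_pos (by norm_num) hμ, Real.rpow_natCast]
    rw [← this, ← Real.rpow_natCast, ← Real.rpow_mul two_pos.le, mul_comm,
      Real.rpow_mul two_pos.le, Real.rpow_natCast]
  have hy1 : 1 ≤ x / 2 ^ k := (one_le_div h2k0).2 hx1
  have hy2 : x / 2 ^ k ≤ 2 ^ M := (div_le_iff₀ h2k0).2 hx2
  -- The sign of α is left open, so the ratio x / 2^k is charged with exponent |α|.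
  have h2 : ((2 : ℝ) ^ k) ^ α = (x / 2 ^ k) ^ (-α) * x ^ α := by
    rw [Real.rpow_neg (by linarith), Real.div_rpow (by linarith) h2k0.le, inv_div,
      div_mul_cancel₀ _ (Real.rpow_pos_of_pos (by linarith) _).ne']
  rw [h1, h2]
  refine mul_le_mul ?_ (Real.rpow_le_rpow_of_exponent_le hx ?_)
    (Real.rpow_nonneg (by linarith) _) (by positivity)
  · exact (Real.rpow_le_rpow_of_exponent_le hy1 (neg_le_abs α)).trans
      (Real.rpow_le_rpow (by linarith) hy2 (abs_nonneg α))
  · exact sub_le_sub_right (Real.logb_le_logb_of_le one_lt_two hμ hμν) _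

theorem exists_badSet_density_bound (m : ℕ) (hm : 1 ≤ m) :
    ∃ K : ℝ, 0 < K ∧ ∀ l r : ℕ, 1 ≤ r → r ≤ 2 ^ l →
      ((badSet m (2 ^ l) r).card : ℝ) / ((2 ^ l : ℕ) : ℝ) ^ m ≤
        K * (((2 ^ l : ℕ) : ℝ) / r) ^ (Real.logb 2 (topEigenvalue m) - m) := by
  obtain ⟨μ, hμ0, hμ, K, hK0, hK⟩ := exists_card_badSet_bound m hm
  have hμtop : μ ≤ topEigenvalue m := (isGreatest_topEigenvalue m hm).2 hμ
  refine ⟨K * ((2 : ℝ) ^ (m + 1)) ^ |Real.logb 2 μ - m|, by positivity, fun l r hr hrl => ?_⟩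
  set ρ₀ := Nat.clog 2 r with hρ₀
  have hr1 : r ≤ 2 ^ ρ₀ := Nat.le_pow_clog one_lt_two r
  have hr2 : 2 ^ ρ₀ < 2 * r := by
    rcases Nat.eq_zero_or_pos ρ₀ with h0 | h0
    · rw [h0]; omega
    · have : 2 ^ (ρ₀ - 1) < r := (Nat.lt_clog_iff_pow_lt one_lt_two).1 (by omega)
      obtain ⟨t, ht⟩ := Nat.exists_eq_succ_of_ne_zero h0.ne'
      rw [ht, Nat.succ_sub_one] at this
      rw [ht, pow_succ]
      omega
  have hρ₀l : ρ₀ ≤ l := Nat.clog_le_of_le_pow hrl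
  -- Here 2^ρ₀ is r rounded up to a power of two; m further bits secure 2^ρ ≥ r + m - 1. If they
  -- exceed l, then ρ = l. Either way 2^(l-ρ) is within a factor 2^(m+1) of q/r.
  set ρ := min (ρ₀ + m) l with hρ
  have hρl : ρ ≤ l := min_le_right _ _
  have hcond : r + m ≤ 2 ^ ρ + 1 ∨ ρ = l := by
    rcases le_total (ρ₀ + m) l with h | h
    · left
      rw [hρ, min_eq_left h, pow_add]
      have h1 : m + 1 ≤ 2 ^ m := Nat.lt_two_pow_self
      have h2 : 2 ^ ρ₀ * (m + 1) ≤ 2 ^ ρ₀ * 2 ^ m := Nat.mul_le_mul_left _ h1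
      have h3 : 1 * m ≤ 2 ^ ρ₀ * m := Nat.mul_le_mul_right _ Nat.one_le_two_pow
      rw [mul_add] at h2
      omega
    · right
      rw [hρ, min_eq_right h]
  have hb := hK l ρ r hρl hcond
  obtain ⟨k, hk⟩ := Nat.exists_eq_add_of_le hρl
  have hr0 : (0 : ℝ) < r := by exact_mod_cast hr
  have hx1 : (2 : ℝ) ^ k ≤ ((2 ^ l : ℕ) : ℝ) / r := by
    rw [le_div_iff₀ hr0]
    have : 2 ^ k * r ≤ 2 ^ l := by
      rcases le_total (ρ₀ + m) l with h | h
      · calc 2 ^ k * r ≤ 2 ^ k * 2 ^ ρ₀ := Nat.mul_le_mul_left _ hr1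
          _ = 2 ^ (k + ρ₀) := (pow_add _ _ _).symm
          _ ≤ 2 ^ l := Nat.pow_le_pow_right two_pos (by omega)
      · have : k = 0 := by omega
        rw [this, pow_zero, one_mul]; exact hrl
    exact_mod_cast this
  have hx2 : ((2 ^ l : ℕ) : ℝ) / r ≤ 2 ^ (m + 1) * 2 ^ k := by
    rw [div_le_iff₀ hr0]
    have : 2 ^ l ≤ 2 ^ (m + 1) * 2 ^ k * r := by
      calc 2 ^ l ≤ 2 ^ (m + k + ρ₀) := Nat.pow_le_pow_right two_pos (by omega)
        _ = 2 ^ m * 2 ^ k * 2 ^ ρ₀ := by rw [pow_add, pow_add]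
        _ ≤ 2 ^ m * 2 ^ k * (2 * r) := Nat.mul_le_mul_left _ hr2.le
        _ = _ := by ring
    exact_mod_cast this
  have hcomp := pow_div_le_rpow hμ0 hμtop m k (m + 1) hx1 hx2
  have hkl : l - ρ = k := by omega
  rw [hkl] at hb
  calc ((badSet m (2 ^ l) r).card : ℝ) / ((2 ^ l : ℕ) : ℝ) ^ m
      ≤ K * ((2 ^ ρ) ^ m * μ ^ k) / ((2 ^ l : ℕ) : ℝ) ^ m := by gcongr
    _ = K * (μ / 2 ^ m) ^ k := by
        rw [hk]
        push_cast
        rw [pow_add, mul_pow, div_pow, ← pow_mul 2 m k, ← pow_mul 2 k m, mul_comm m k]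
        field_simp
    _ ≤ _ := by
        rw [mul_assoc]
        exact mul_le_mul_of_nonneg_left hcomp hK0.le

end LiftedMult

end

/-! ### The main theorem -/

theorem mainTheorem1 (m : ℕ) (hm : 1 ≤ m) :
    IsGreatest (LiftedMult.eigenvaluesA m) (LiftedMult.topEigenvalue m) ∧
    (∃ K : ℝ, ∃ q₀ : ℕ, ∀ s q r : ℕ, LiftedMult.Admissible m s q r → q₀ ≤ q →
      ∀ (F : Type u) [Field F] [Fintype F], Fintype.card F = q →
        |1 - LiftedMult.codeRate (LiftedMult.liftedMultiplicityCode m s (q * s - r) F)| ≤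
          K * ((s : ℝ)⁻¹ *
            ((q : ℝ) / (r : ℝ)) ^ (Real.logb 2 (LiftedMult.topEigenvalue m) - (m : ℝ)))) ∧
    (∀ s q r : ℕ, LiftedMult.Admissible m s q r →
      ∀ (F : Type u) [Field F] [Fintype F], Fintype.card F = q →
        ((LiftedMult.deltaMin s q r : ℝ) : EReal) ≤
          LiftedMult.relativeDistance (LiftedMult.liftedMultiplicityCode m s (q * s - r) F)) ∧
    (∀ s q r : ℕ → ℕ, (∀ n, LiftedMult.Admissible m (s n) (q n) (r n)) →
      Tendsto q atTop atTop →
      (fun n => (s n : ℝ)) =o[atTop] (fun n => (q n : ℝ)) →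
      ((fun n => LiftedMult.deltaMin (s n) (q n) (r n)) ~[atTop]
          (fun n => (r n : ℝ) / ((q n : ℝ) * (s n : ℝ))) ↔
        (fun n => ((r n % s n : ℕ) : ℝ)) =o[atTop] (fun n => (r n : ℝ)))) := by
  refine ⟨LiftedMult.isGreatest_topEigenvalue m hm, ?_, ?_, ?_⟩
  · obtain ⟨K, hK0, hK⟩ := LiftedMult.exists_badSet_density_bound m hm
    -- The estimate holds for every admissible q, so the threshold is 0.
    refine ⟨m ^ (m + 1) * K, 0, ?_⟩
    rintro s q r ⟨-, ⟨l, hl⟩, hms, -, hr1, hrq⟩ - F _ _ rfl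
    have h2 : CharP F 2 := by
      have : ringChar F = 2 :=
        (Nat.prime_dvd_prime_iff_eq (CharP.char_is_prime F _) Nat.prime_two).1
          ((CharP.char_is_prime F _).dvd_of_dvd_pow
            (hl ▸ (ringChar.spec F _).1 (FiniteField.cast_card_eq_zero F)))
      exact this ▸ ringChar.charP F
    refine (LiftedMult.abs_one_sub_codeRate_le_badSet hm (hm.trans hms) hrq).trans ?_
    rw [mul_assoc, mul_left_comm K]
    have := hK l r hr1 (hl ▸ hrq)
    rw [← hl] at this
    gcongr
  · rintro s q r ⟨-, -, hms, hsq, -⟩ F _ _ rfl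
    exact LiftedMult.deltaMin_le_relativeDistance (hm.trans hms) hsq
  · intro s q r h _ hsq
    exact LiftedMult.deltaMin_isEquivalent_iff s q r (fun n => hm.trans (h n).2.2.1)
      (fun n => (hm.trans (h n).2.2.1).trans (h n).2.2.2.1) (fun n => (h n).2.2.2.2.1) hsq
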